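/- Let $n\ge 2$ and let $G\subset SU(n)$ be a finite subgroup acting freely on $\mathbb{C}^n\setminus\{0\}$. Let $\pi_G:S^{2n-1}\to S_G=S^{2n-1}/G$ be the quotient map, let $\xi_G$ be the contact structure on $S_G$ induced by the round contact structure $\xi$ on $S^{2n-1}$, and let the Reeb flow on $S_G$ be $\phi_t([z])=[e^{it}z]$ (the flow of the Reeb field of the contact form induced by $\tfrac12\sum (x_jdy_j-y_jdx_j)$ is $\phi_{2t}$; lengths of orbits are measured in the parameter of $\phi$). For $g\in G$ and $\ell>0$ put $$V_{g,\ell}=\{v\in\mathbb{C}^n: g(v)=e^{i\ell}v\},\qquad B_{g,\ell}=\pi_G(V_{g,\ell}\cap S^{2n-1})\subset S_G .$$ Up to conjugation these depend only on the conjugacy class of $g$. A point $p\in B_{g,\ell}$ is identified with the closed Reeb orbit $\gamma:\mathbb{R}/\ell\mathbb{Z}\to S_G$, $\gamma(t)=\phi_t(p)$, of length $\ell$. Write the eigenvalues of $g^{-1}$, with multiplicity, as $e^{ia_1},\dots,e^{ia_n}$ with $a_j\in[0,2\pi)$, and let $\mathrm{age}(g)=\frac1{2\pi}\sum_j a_j$.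 The canonical bundle of $\xi_G$ is trivialised by the section $K_G$ induced by $K=\iota_E(dz_1\wedge\dots\wedge dz_n)$, where $E=\sum_j z_j\partial_{z_j}$. The Conley–Zehnder index of a closed Reeb orbit $\gamma$ of length $\ell$ is the (Robbin–Salamon) Conley–Zehnder index of the path $\tau_{\gamma(t)}\circ D\phi_t\circ\tau_{\gamma(0)}^{-1}$, $0\le t\le\ell$, of symplectic matrices, for any unitary trivialisation $\tau:\gamma^*\xi_G\to(\mathbb{R}/\ell\mathbb{Z})\times\mathbb{C}^{n-1}$ that takes $K_G$ to $dz_1\wedge\dots\wedge dz_{n-1}$ (such $\tau$ exist). If all orbits of length $\ell$ starting in a submanifold $B\ne\emptyset$ are closed orbits contained in $B$ with one common index, that index is denoted $\mathrm{CZ}(B)$, and the associated grading is $$\mu(B)=n-\mathrm{CZ}(B)-\tfrac12-\tfrac12\dim B .$$ The family $B$ contributes a copy of $H^*(B)$ shifted up in degree by $\mu(B)$, so the maximum of $B$ (the generator of the top degree of $H^*(B)$) has grading $\mu(B)+\dim B$. **Theorem.** Let $g\in G$ and $0<\ell\le2\pi$ with $V_{g,\ell}\neq0$, and let $B=B_{g,\ell}$.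 Then all Reeb orbits of length $\ell$ in $B$ have the same Conley–Zehnder index, and $$\mathrm{CZ}(B)=n-2\,\mathrm{age}(g)+2\sum_{0<\ell'<\ell}\dim_{\mathbb{C}}V_{g,\ell'}+\tfrac12\dim B+\tfrac12,$$ $$\mu(B)=2\,\mathrm{age}(g)-2\sum_{0<\ell'<\ell}\dim_{\mathbb{C}}V_{g,\ell'}-\dim B-1 .$$ For every $k\in\mathbb{N}$ (orbits of length $\ell+2\pi k$), $$\mathrm{CZ}(B_{g,\ell+2\pi k})=\mathrm{CZ}(B_{g,\ell})+2kn,\qquad \mu(B_{g,\ell+2\pi k})=\mu(B_{g,\ell})-2kn .$$ If $e^{i\ell}$ is the minimal eigenvalue of $g$, that is, $\ell$ is the least number in $(0,2\pi]$ with $V_{g,\ell}\ne0$, then $\mu(B)=2\,\mathrm{age}(g)-\dim B-1$, every Reeb orbit of length $\ell$ starting in $B$ is a minimal Reeb orbit of $g$ (that is, of the form $t\mapsto[e^{it}v]$ for a unit vector $v$ with $g(v)=e^{i\ell}v$), and the maximum of $B$ has grading $2\,\mathrm{age}(g)-1$. -/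

import Mathlib

open scoped Real InnerProductSpace Matrix

noncomputable section

namespace QuotientCZ

/-! ## The Conley–Zehnder (Robbin–Salamon) index of a path of symplectic matrices

The plane `ℂ^m = ℝ^m ⊕ i ℝ^m` is identified with `ℝ^m ⊕ ℝ^m`, `x + i y ↔ (x, y)`, with the standard
form `∑ dx_j ∧ dy_j`.  The index of a path `A` in `Sp(2m, ℝ)` is the Maslov index of the path of
Lagrangians `graph (A t) ⊆ (ℂ^m ⊕ ℂ^m, (-ω) ⊕ ω)` relative to the diagonal, crossings at the
endpoints being counted with weight one half.  It is defined here by Souriau's formula (the one of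
the Leray–Souriau index): a Lagrangian is sent to the unitary matrix `Z (conj Z)⁻¹` of any frame
`Z`, the angle of the determinant is followed continuously along the path, and the contribution of
the two ends is the sum of a sawtooth function over the eigenvalues relative to the diagonal. -/

/-- `δ` is the total variation `θ(T) - θ(0)` of a continuous argument `θ` of `f` along `[0, T]`. -/
def IsArgVariation (f : ℝ → ℂ) (T δ : ℝ) : Prop :=
  ∃ θ : ℝ → ℝ, ContinuousOn θ (Set.Icc 0 T) ∧
    (∀ t ∈ Set.Icc 0 T, f t = (‖f t‖ : ℂ) * Complex.exp (θ t * Complex.I)) ∧ δ = θ T - θ 0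

/-- The variation of the argument along `[0, T]` of a continuous nowhere zero function
(for which such a number exists and is unique). -/
def argVariation (f : ℝ → ℂ) (T : ℝ) : ℝ := Classical.epsilon (IsArgVariation f T)

variable {m : ℕ}

/-- The frame of `graph A`, `A` a real matrix on `ℝ^m ⊕ ℝ^m`, whose columns are the
vectors `(v, A v)` for `v` in the standard real basis `e_1, …, e_m, i e_1, …, i e_m` of `ℂ^m`.  They
are written in the coordinates `(z̄, w)` of `(z, w) ∈ ℂ^m ⊕ ℂ^m`, which are holomorphic for the
complex structure `(-J) ⊕ J` compatible with `(-ω) ⊕ ω`. -/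
def graphFrame (A : Matrix (Fin m ⊕ Fin m) (Fin m ⊕ Fin m) ℝ) :
    Matrix (Fin m ⊕ Fin m) (Fin m ⊕ Fin m) ℂ :=
  Matrix.fromBlocks 1 (-(Complex.I • (1 : Matrix (Fin m) (Fin m) ℂ)))
    (A.toBlocks₁₁.map Complex.ofReal + Complex.I • A.toBlocks₂₁.map Complex.ofReal)
    (A.toBlocks₁₂.map Complex.ofReal + Complex.I • A.toBlocks₂₂.map Complex.ofReal)

/-- The Souriau matrix `Z (conj Z)⁻¹` of the Lagrangian spanned over `ℝ` by the columns of `Z`. -/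
def souriau (Z : Matrix (Fin m ⊕ Fin m) (Fin m ⊕ Fin m) ℂ) :
    Matrix (Fin m ⊕ Fin m) (Fin m ⊕ Fin m) ℂ :=
  Z * (Z.map (starRingEnd ℂ))⁻¹

/-- The Souriau matrix of `graph A` relative to the diagonal.  It is unitary for symplectic `A`, and
its eigenvalue `1` has multiplicity `dim ker (A - 1)`. -/
def relativeSouriau (A : Matrix (Fin m ⊕ Fin m) (Fin m ⊕ Fin m) ℝ) :
    Matrix (Fin m ⊕ Fin m) (Fin m ⊕ Fin m) ℂ :=
  souriau (graphFrame A) * (souriau (graphFrame (1 : Matrix (Fin m ⊕ Fin m) (Fin m ⊕ Fin m) ℝ)))⁻¹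

open Classical in
/-- The sawtooth function on the circle: `0` at `1`, and `1/2 - φ/2π` at `e^{iφ}` for
`0 < φ < 2π` (then `arg (-e^{iφ}) = φ - π`). -/
def sawtooth (z : ℂ) : ℝ := if z = 1 then 0 else -Complex.arg (-z) / (2 * π)

/-- The contribution of an end of the path: the sum of the sawtooth function over the
eigenvalues, with multiplicity, of the relative Souriau matrix. -/
def endCorrection (A : Matrix (Fin m ⊕ Fin m) (Fin m ⊕ Fin m) ℝ) : ℝ :=
  ((relativeSouriau A).charpoly.roots.map sawtooth).sum

/-- The Conley–Zehnder index of the continuous path `A t`, `0 ≤ t ≤ T`, of symplectic matrices on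
`ℝ^m ⊕ ℝ^m`.  With `Z t` the frame of the graph, `2 arg det (Z t)` is the argument of the determinant
of the Souriau matrix.  If `θ_j` are continuous arguments of the eigenvalues of the relative Souriau
matrix, this number is the sum over `j` of `½ (W (θ_j T) - W (θ_j 0))`, where `W θ = θ/π` for
`θ ∈ 2πℤ` and `W θ = 2⌊θ/2π⌋ + 1` otherwise. -/
def czIndex (A : ℝ → Matrix (Fin m ⊕ Fin m) (Fin m ⊕ Fin m) ℝ) (T : ℝ) : ℝ :=
  argVariation (fun t => (graphFrame (A t)).det) T / π + endCorrection (A T) - endCorrection (A 0)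

/-- The real matrix on `ℝ^m ⊕ ℝ^m` of a complex matrix on `ℂ^m`. -/
def realification (M : Matrix (Fin m) (Fin m) ℂ) : Matrix (Fin m ⊕ Fin m) (Fin m ⊕ Fin m) ℝ :=
  Matrix.fromBlocks (M.map Complex.re) (-(M.map Complex.im)) (M.map Complex.im) (M.map Complex.re)

/-! ## The round contact sphere `S^{2n-1} ⊆ ℂ^n`, `n = m + 1` -/

/-- `ℂ^n` with `n = m + 1`. -/
abbrev Cn (m : ℕ) := EuclideanSpace ℂ (Fin (m + 1))

/-- The unit sphere `S^{2n-1}`. -/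
abbrev Sph (m : ℕ) := Metric.sphere (0 : Cn m) 1

/-- The group `SU(n)`. -/
abbrev SU (m : ℕ) := Matrix.specialUnitaryGroup (Fin (m + 1)) ℂ

/-- The symplectic form `ω = ∑ dx_j ∧ dy_j`. -/
def symplecticForm (u w : Cn m) : ℝ := ∑ j, ((u j).re * (w j).im - (u j).im * (w j).re)

/-- The primitive `θ = ½ ∑ (x_j dy_j - y_j dx_j)` at `z`; its restriction to the unit sphere is the
round contact form. -/
def contactForm (z w : Cn m) : ℝ := (1 / 2) * ∑ j, ((z j).re * (w j).im - (z j).im * (w j).re)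

/-- The contact hyperplane `ξ_z`, as a complex subspace of `ℂ^n`: see `mem_xi_iff`. -/
def xi (z : Cn m) : Submodule ℂ (Cn m) := (ℂ ∙ z)ᗮ

theorem inner_im (z w : Cn m) : (inner ℂ z w : ℂ).im = symplecticForm z w := by
  simp only [PiLp.inner_apply, RCLike.inner_apply, Complex.im_sum, symplecticForm]
  refine Finset.sum_congr rfl fun j _ => ?_
  simp [Complex.mul_im]
  ring

theorem contactForm_eq (z w : Cn m) : contactForm z w = (1 / 2) * symplecticForm z w := rfl

/-- On the unit sphere `ξ_z` is the kernel of the contact form on the tangent space of the sphere. -/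
theorem mem_xi_iff (z w : Cn m) :
    w ∈ xi z ↔ (inner ℂ z w : ℂ).re = 0 ∧ contactForm z w = 0 := by
  rw [xi, Submodule.mem_orthogonal_singleton_iff_inner_right, Complex.ext_iff, inner_im,
    contactForm_eq]
  simp

/-- The Reeb flow `φ_t z = e^{it} z` (the flow of the Reeb field of the round contact form is
`φ_{2t}`: see `hasDerivAt_reeb` and the two lemmas after it; lengths of orbits are measured by the
parameter of `φ`). -/
def rot (t : ℝ) (z : Cn m) : Cn m := Complex.exp (t * Complex.I) • z

theorem hasDerivAt_reeb (z : Cn m) (t : ℝ) :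
    HasDerivAt (fun s : ℝ => rot (2 * s) z) ((2 * Complex.I) • rot (2 * t) z) t := by
  have h1 : HasDerivAt (fun s : ℝ => (((2 * s : ℝ) : ℂ) * Complex.I)) (2 * Complex.I) t := by
    have := ((hasDerivAt_id t).const_mul (2 : ℝ)).ofReal_comp.mul_const Complex.I
    simpa using this
  have h2 := h1.cexp.smul_const z
  refine HasDerivAt.congr_deriv (f := fun s : ℝ => rot (2 * s) z) h2 ?_
  simp only [rot, smul_smul]
  rw [mul_comm]

/-- The field `2 i z` has contact form one along the unit sphere. -/
theorem contactForm_reeb (z : Sph m) : contactForm z.1 ((2 * Complex.I) • z.1) = 1 := by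
  rw [contactForm_eq, ← inner_im, inner_smul_right, inner_self_eq_norm_sq_to_K]
  simp

/-- The field `2 i z` is in the kernel of `dα` on the tangent space of the sphere. -/
theorem symplecticForm_reeb (z w : Cn m) (h : (inner ℂ z w : ℂ).re = 0) :
    symplecticForm ((2 * Complex.I) • z) w = 0 := by
  rw [← inner_im, inner_smul_left]
  simp [h]

/-- The linear map `φ_t` is its own derivative. -/
theorem hasFDerivAt_rot (t : ℝ) (z : Cn m) :
    HasFDerivAt (𝕜 := ℝ) (rot t)
      ((Complex.exp (t * Complex.I) • ContinuousLinearMap.id ℂ (Cn m)).restrictScalars ℝ) z :=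
  ((Complex.exp (t * Complex.I) •
    ContinuousLinearMap.id ℂ (Cn m)).restrictScalars ℝ).hasFDerivAt

theorem norm_rot (t : ℝ) (z : Cn m) : ‖rot t z‖ = ‖z‖ := by
  rw [rot, norm_smul, Complex.norm_exp_ofReal_mul_I, one_mul]

theorem inner_rot (t : ℝ) (z w : Cn m) : (inner ℂ (rot t z) (rot t w) : ℂ) = inner ℂ z w := by
  rw [rot, rot, inner_smul_left, inner_smul_right, ← mul_assoc, ← Complex.normSq_eq_conj_mul_self,
    Complex.normSq_eq_norm_sq, Complex.norm_exp_ofReal_mul_I]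
  simp

/-- The total space of the contact structure `ξ` over the sphere. -/
abbrev Xi (m : ℕ) := {x : Sph m × Cn m // x.2 ∈ xi x.1.1}

/-- The Reeb flow on the sphere. -/
def flowSph (t : ℝ) (z : Sph m) : Sph m := ⟨rot t z.1, by
  rw [mem_sphere_zero_iff_norm, norm_rot]; exact mem_sphere_zero_iff_norm.1 z.2⟩

/-- The linearised Reeb flow `Dφ_t` on `ξ`. -/
def flowXi (t : ℝ) (x : Xi m) : Xi m := ⟨(flowSph t x.1.1, rot t x.1.2), by
  have h := x.2
  rw [xi, Submodule.mem_orthogonal_singleton_iff_inner_right] at h ⊢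
  exact (inner_rot t _ _).trans h⟩

/-! ## The action of `SU(n)` -/

/-- The standard action of a matrix on `ℂ^n`. -/
def act (A : SU m) (z : Cn m) : Cn m := WithLp.toLp 2 (A.1 *ᵥ z.ofLp)

theorem act_one (z : Cn m) : act 1 z = z := by simp [act]

theorem act_mul (A B : SU m) (z : Cn m) : act (A * B) z = act A (act B z) := by
  simp [act, Matrix.mulVec_mulVec]

theorem act_smul (A : SU m) (c : ℂ) (z : Cn m) : act A (c • z) = c • act A z := by
  simp [act, Matrix.mulVec_smul]

theorem inner_act (A : SU m) (z w : Cn m) : (inner ℂ (act A z) (act A w) : ℂ) = inner ℂ z w := by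
  have hA : A.1ᴴ * A.1 = 1 :=
    Matrix.mem_unitaryGroup_iff'.1 (Matrix.specialUnitaryGroup_le_unitaryGroup A.2)
  simp only [EuclideanSpace.inner_eq_star_dotProduct, act]
  rw [Matrix.star_mulVec, dotProduct_comm, ← Matrix.dotProduct_mulVec, Matrix.mulVec_mulVec, hA,
    Matrix.one_mulVec, dotProduct_comm]

theorem norm_act (A : SU m) (z : Cn m) : ‖act A z‖ = ‖z‖ := by
  rw [@norm_eq_sqrt_re_inner ℂ, @norm_eq_sqrt_re_inner ℂ, inner_act]

instance : MulAction (SU m) (Sph m) where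
  smul A z := ⟨act A z.1, by
    rw [mem_sphere_zero_iff_norm, norm_act]; exact mem_sphere_zero_iff_norm.1 z.2⟩
  one_smul z := Subtype.ext (act_one z.1)
  mul_smul A B z := Subtype.ext (act_mul A B z.1)

theorem coe_smul_sph (A : SU m) (z : Sph m) : (A • z).1 = act A z.1 := rfl

instance : MulAction (SU m) (Xi m) where
  smul A x := ⟨(A • x.1.1, act A x.1.2), by
    have h := x.2
    rw [xi, Submodule.mem_orthogonal_singleton_iff_inner_right] at h ⊢
    exact (inner_act A _ _).trans h⟩
  one_smul x := Subtype.ext (Prod.ext (one_smul _ x.1.1) (act_one x.1.2))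
  mul_smul A B x := Subtype.ext (Prod.ext (mul_smul A B x.1.1) (act_mul A B x.1.2))

theorem coe_smul_xi (A : SU m) (x : Xi m) : (A • x).1 = (A • x.1.1, act A x.1.2) := rfl

theorem flowSph_smul (t : ℝ) (A : SU m) (z : Sph m) : flowSph t (A • z) = A • flowSph t z :=
  Subtype.ext (act_smul A _ z.1).symm

theorem flowXi_smul (t : ℝ) (A : SU m) (x : Xi m) : flowXi t (A • x) = A • flowXi t x :=
  Subtype.ext (Prod.ext (flowSph_smul t A x.1.1) (act_smul A _ x.1.2).symm)

/-- `G` acts freely on `ℂ^n ∖ 0`. -/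
def ActsFreely (G : Subgroup (SU m)) : Prop :=
  ∀ h ∈ G, h ≠ 1 → ∀ z : Cn m, z ≠ 0 → act h z ≠ z

/-! ## The quotient `S_G = S^{2n-1}/G` with its contact structure and Reeb flow -/

variable (G : Subgroup (SU m))

/-- The quotient `S_G = S^{2n-1}/G`, with the quotient topology. -/
abbrev SG := MulAction.orbitRel.Quotient G (Sph m)

/-- The total space of the contact structure `ξ_G` over `S_G`, with the quotient topology. -/
abbrev XiG := MulAction.orbitRel.Quotient G (Xi m)

/-- The quotient map `π_G`. -/
def piG (z : Sph m) : SG G := Quotient.mk _ z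

/-- The quotient map `ξ → ξ_G`. -/
def piXi (x : Xi m) : XiG G := Quotient.mk _ x

/-- The bundle projection `ξ_G → S_G`. -/
def projG : XiG G → SG G :=
  Quotient.map (fun x => x.1.1) (by
    rintro x y ⟨h, rfl⟩
    exact ⟨h, rfl⟩)

/-- The Reeb flow on `S_G`. -/
def flowG (t : ℝ) : SG G → SG G :=
  Quotient.map (flowSph t) (by
    rintro x y ⟨h, rfl⟩
    exact ⟨h, (flowSph_smul t h.1 y).symm⟩)

/-- The linearised Reeb flow on `ξ_G`. -/
def flowXiG (t : ℝ) : XiG G → XiG G :=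
  Quotient.map (flowXi t) (by
    rintro x y ⟨h, rfl⟩
    exact ⟨h, (flowXi_smul t h.1 y).symm⟩)

theorem projG_flowXiG (t : ℝ) (x : XiG G) : projG G (flowXiG G t x) = flowG G t (projG G x) := by
  induction x using Quotient.inductionOn
  rfl

theorem projG_piXi (x : Xi m) : projG G (piXi G x) = piG G x.1.1 := rfl

/-- The fibre of `ξ_G` over `p`.  For a representative `z` of `p`, the map `w ↦ [z, w]` is a bijection
from `ξ_z` onto it (if the action is free), through which it is a Hermitian vector space. -/
abbrev Fiber (p : SG G) := {x : XiG G // projG G x = p}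

variable {G}

/-- The element `[z, w]` of the fibre of `ξ_G` over `p = [z]`. -/
def fiberMk {p : SG G} (z : Sph m) (hz : piG G z = p) (w : xi z.1) : Fiber G p :=
  ⟨piXi G ⟨(z, w.1), w.2⟩, hz⟩

variable (G) in
/-- A Reeb orbit of length `ℓ` in `S_G`: an `ℓ`-periodic orbit of the Reeb flow. -/
structure ReebOrbit (ℓ : ℝ) where
  toFun : AddCircle ℓ → SG G
  flow : ∀ t : ℝ, toFun (t : AddCircle ℓ) = flowG G t (toFun 0)

/-- The section `K = ι_E (dz_1 ∧ … ∧ dz_n)` of the canonical bundle of `ξ`, where `E` is the Euler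
vector field: `K_z (w_1, …, w_{n-1}) = det (z, w_1, …, w_{n-1})`.  It is invariant under `SU(n)`. -/
def sectionK (z : Sph m) (w : Fin m → xi z.1) : ℂ :=
  Matrix.det (Matrix.of
    (Fin.cons (α := fun _ => Fin (m + 1) → ℂ) z.1.ofLp (fun j => (w j).1.ofLp)))

/-- A trivialisation `τ : γ^* ξ_G → (ℝ/ℓℤ) × ℂ^{n-1}` of Hermitian bundles such that the induced
trivialisation of the canonical bundle satisfies `(Λ^{n-1} τ)(K_G) = dz_1 ∧ … ∧ dz_{n-1}`. -/
structure CompatibleTrivialization {ℓ : ℝ} (γ : ReebOrbit G ℓ) where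
  /-- the map between the fibres over `s` -/
  toEquiv : ∀ s : AddCircle ℓ, Fiber G (γ.toFun s) ≃ EuclideanSpace ℂ (Fin m)
  /-- `τ` is continuous on the total space of `γ^* ξ_G` -/
  continuous_toFun : Continuous
    (fun x : {x : AddCircle ℓ × XiG G // projG G x.2 = γ.toFun x.1} => toEquiv x.1.1 ⟨x.1.2, x.2⟩)
  /-- `τ` is complex linear and unitary on each fibre -/
  unitary : ∀ (s : AddCircle ℓ) (z : Sph m) (hz : piG G z = γ.toFun s),
    ∃ e : xi z.1 ≃ₗᵢ[ℂ] EuclideanSpace ℂ (Fin m), ∀ w, toEquiv s (fiberMk z hz w) = e w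
  /-- `τ` takes `K_G` to `dz_1 ∧ … ∧ dz_{n-1}` -/
  compatible : ∀ (s : AddCircle ℓ) (z : Sph m) (hz : piG G z = γ.toFun s) (w : Fin m → xi z.1),
    sectionK z w = Matrix.det (Matrix.of fun j => (toEquiv s (fiberMk z hz (w j))).ofLp)

namespace CompatibleTrivialization

variable {ℓ : ℝ} {γ : ReebOrbit G ℓ}

/-- The map `τ_{γ(t)} ∘ Dφ_t ∘ τ_{γ(0)}⁻¹ : ℂ^{n-1} → ℂ^{n-1}`. -/
def flowMap (τ : CompatibleTrivialization γ) (t : ℝ) (v : EuclideanSpace ℂ (Fin m)) :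
    EuclideanSpace ℂ (Fin m) :=
  τ.toEquiv (t : AddCircle ℓ) ⟨flowXiG G t ((τ.toEquiv 0).symm v).1, by
    rw [projG_flowXiG, ((τ.toEquiv 0).symm v).2, γ.flow t]⟩

/-- The path of symplectic matrices of the linearised Reeb flow along `γ`. -/
def flowMatrix (τ : CompatibleTrivialization γ) (t : ℝ) :
    Matrix (Fin m ⊕ Fin m) (Fin m ⊕ Fin m) ℝ :=
  realification (Matrix.of fun i j => (τ.flowMap t (EuclideanSpace.single j 1)).ofLp i)

end CompatibleTrivialization

/-- `c` is the Conley–Zehnder index of the Reeb orbit `γ`: the linearised flow along `γ` has index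
`c` in every compatible trivialisation, and there is one. -/
def HasCZ {ℓ : ℝ} (γ : ReebOrbit G ℓ) (c : ℝ) : Prop :=
  Nonempty (CompatibleTrivialization γ) ∧
    ∀ τ : CompatibleTrivialization γ, czIndex τ.flowMatrix ℓ = c

/-- `c` is the Conley–Zehnder index of the family `B` of Reeb orbits of length `ℓ`: `B` is non-empty,
through each point of `B` there is a Reeb orbit of length `ℓ` contained in `B`, and all Reeb orbits of
length `ℓ` starting in `B` have index `c`. -/
def IsCZ (B : Set (SG G)) (ℓ c : ℝ) : Prop :=
  B.Nonempty ∧ (∀ p ∈ B, ∃ γ : ReebOrbit G ℓ, γ.toFun 0 = p ∧ ∀ s, γ.toFun s ∈ B) ∧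
    ∀ γ : ReebOrbit G ℓ, γ.toFun 0 ∈ B → HasCZ γ c

/-- The preimage in `ℂ^n` of a subset of `S_G`. -/
def preimageG (B : Set (SG G)) : Set (Cn m) := {z | ∃ h : z ∈ Sph m, piG G ⟨z, h⟩ ∈ B}

/-- The real dimension of a submanifold `B` of `S_G`: the dimension of its tangent spaces, which
are computed on the preimage of `B`, as `π_G` is a covering. -/
def realDim (B : Set (SG G)) : ℕ :=
  sSup {d | ∃ z ∈ preimageG B, d = Module.finrank ℝ (Submodule.span ℝ
    (tangentConeAt ℝ (preimageG B) z))}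

/-- `μ` is the grading `n - CZ(B) - ½ - ½ dim B` of the Morse–Bott family `B` of Reeb orbits of
length `ℓ`. -/
def IsGrading (B : Set (SG G)) (ℓ μ : ℝ) : Prop :=
  ∃ c, IsCZ B ℓ c ∧ μ = ((m + 1 : ℕ) : ℝ) - c - 1 / 2 - (realDim B : ℝ) / 2

/-- `d` is the grading of the maximum of `B`: the family contributes a copy of `H^*(B)` shifted up
by the grading of `B`, and the maximum is the generator of the top degree `dim B`. -/
def IsMaxGrading (B : Set (SG G)) (ℓ d : ℝ) : Prop :=
  ∃ μ, IsGrading B ℓ μ ∧ d = μ + realDim B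

/-! ## Eigenspaces, age, and the families of Reeb orbits -/

/-- The `e^{iℓ}`-eigenspace of `g` on `ℂ^n`. -/
def eigV (g : SU m) (ℓ : ℝ) : Submodule ℂ (Cn m) where
  carrier := {v | act g v = Complex.exp (ℓ * Complex.I) • v}
  zero_mem' := by simp [act]
  add_mem' := by
    intro v w hv hw
    simp only [Set.mem_ofPred_eq] at hv hw ⊢
    rw [smul_add, ← hv, ← hw]
    simp [act, Matrix.mulVec_add]
  smul_mem' := by
    intro c v hv
    simp only [Set.mem_ofPred_eq] at hv ⊢
    rw [act_smul, hv, smul_comm]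

/-- The age of `g`: `(1/2π) ∑ a_j`, where `e^{i a_j}`, `0 ≤ a_j < 2π`, are the eigenvalues of `g⁻¹`
with multiplicity. -/
def age (g : SU m) : ℝ :=
  (1 / (2 * π)) *
    ((g⁻¹).1.charpoly.roots.map fun z => toIcoMod Real.two_pi_pos 0 (Complex.arg z)).sum

variable (G) in
/-- The family `B_{g,ℓ} = π_G (V_{g,ℓ} ∩ S^{2n-1}) ⊆ S_G`. -/
def familyB (g : SU m) (ℓ : ℝ) : Set (SG G) := piG G '' {z | z.1 ∈ eigV g ℓ}

/-- The sum of `dim V_{g,ℓ'}` over `0 < ℓ' < ℓ`. -/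
def dimBelow (g : SU m) (ℓ : ℝ) : ℝ :=
  ∑ᶠ ℓ' ∈ Set.Ioo 0 ℓ, (Module.finrank ℂ (eigV g ℓ') : ℝ)

/-- `e^{iℓ}` is the minimal eigenvalue of `g`: `ℓ` is the least number in `(0, 2π]` for which
`e^{iℓ}` is an eigenvalue of `g`. -/
def IsMinimal (g : SU m) (ℓ : ℝ) : Prop :=
  IsLeast {ℓ' | ℓ' ∈ Set.Ioc 0 (2 * π) ∧ eigV g ℓ' ≠ ⊥} ℓ

/-- `γ` is a minimal Reeb orbit of `g`: it is `t ↦ [e^{it} v]`, `0 ≤ t ≤ ℓ`, for a unit vector `v` with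
`g v = e^{iℓ} v`, and `e^{iℓ}` is the minimal eigenvalue of `g`. -/
def IsMinimalOrbit (g : SU m) {ℓ : ℝ} (γ : ReebOrbit G ℓ) : Prop :=
  IsMinimal g ℓ ∧ ∃ v : Sph m, v.1 ∈ eigV g ℓ ∧
    ∀ t : ℝ, γ.toFun (t : AddCircle ℓ) = piG G (flowSph t v)

end QuotientCZ

end

/-!
A Reeb orbit of length `ℓ` starting in `B_{g,ℓ}` is `t ↦ [e^{it} z]` for a unit vector `z` with
`g z = e^{iℓ} z`.  The linearised flow on `ξ` is multiplication by `e^{it}`, so all of its index comes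
from the trivialisation, and two facts determine it.

* A compatible trivialisation takes `K` to the standard volume form, and `K` is made of `n` vectors
  each of which is multiplied by `e^{it}`; hence the path of unitary matrices has determinant
  `e^{int}`, whatever the trivialisation (`CompatibleTrivialization.det_complexFlowMatrix`).
* Because `[e^{iℓ} z, e^{iℓ} w] = [z, e^{iℓ} g⁻¹ w]`, the end of the path is conjugate to `e^{iℓ} g⁻¹`
  on `z^⊥` (`CompatibleTrivialization.complexFlowMatrix_period`).

For a unitary path from the identity, the frame determinant of the graph is a constant multiple of
the complex determinant, and the relative Souriau matrix is `diag(Mᵀ, M)`.  Souriau's formula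
therefore gives the index `nℓ/π + 2 ∑ sawtooth(λ)` over the eigenvalues `λ` of the end of the path
(`czIndex_realification`).  The eigenvalue of `e^{iℓ} g⁻¹` on `z` itself is `1`, where the sawtooth
vanishes, so the sum may be taken over all eigenvalues `e^{i(ℓ - c_j)}`, `0 < c_j ≤ 2π`, and counting
those with `c_j < ℓ` and `c_j = ℓ` gives the formula (`EigenFrame.sum_sawtooth`).  Replacing `ℓ` by
`ℓ + 2πk` leaves the sum alone and adds `2kn`.

A compatible trivialisation exists: an orthonormal eigenbasis of `g` on `z^⊥` is turned by phases that
close up over a period and have the right sum, which is possible as `det g = 1`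
(`exists_phase`, `nonempty_compatibleTrivialization`).  The total space of `γ^* ξ_G` is a quotient of
a subset of `ℝ × ξ` by an open map, and by freeness that subset is a finite disjoint union of closed
pieces on which the trivialisation has an explicit continuous formula.

Finally `dim B_{g,ℓ} = 2 dim V_{g,ℓ} - 1`: by freeness the eigenspaces of the conjugates of `g` meet
only in `0` unless they agree, so the preimage of `B_{g,ℓ}` is locally the unit sphere of one of them
(`realDim_familyB`).
-/

noncomputable section

namespace QuotientCZ

variable {m : ℕ} {G : Subgroup (SU m)}

/-! ### The index of a path of unitary matrices -/

theorem exists_int_of_exp_eq {x y : ℝ}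
    (h : Complex.exp (x * Complex.I) = Complex.exp (y * Complex.I)) :
    ∃ k : ℤ, x = y + 2 * π * k := by
  obtain ⟨k, hk⟩ := Complex.exp_eq_exp_iff_exists_int.1 h
  refine ⟨k, ?_⟩
  have h3 : (x : ℂ) * Complex.I = ((y + 2 * π * k : ℝ) : ℂ) * Complex.I := by
    push_cast
    linear_combination hk
  exact_mod_cast mul_right_cancel₀ Complex.I_ne_zero h3

theorem IsArgVariation.unique {f : ℝ → ℂ} {T δ δ' : ℝ} (hT : 0 ≤ T)
    (hf : ∀ t ∈ Set.Icc 0 T, f t ≠ 0) (h : IsArgVariation f T δ) (h' : IsArgVariation f T δ') :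
    δ = δ' := by
  obtain ⟨θ, hc, hθ, rfl⟩ := h
  obtain ⟨θ', hc', hθ', rfl⟩ := h'
  have key : ∀ t ∈ Set.Icc 0 T, ∃ k : ℤ, θ t - θ' t = k * (2 * π) := by
    intro t ht
    have h1 := (hθ t ht).symm.trans (hθ' t ht)
    have h2 := mul_left_cancel₀ (by simpa using hf t ht) h1
    obtain ⟨k, hk⟩ := exists_int_of_exp_eq h2
    exact ⟨k, by rw [hk]; ring⟩
  have hc2 : ContinuousOn (fun t => (θ t - θ' t) / (2 * π)) (Set.Icc 0 T) :=
    (hc.sub hc').div_const _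
  have hm : Set.MapsTo (fun t => (θ t - θ' t) / (2 * π)) (Set.Icc 0 T)
      (Set.range ((↑) : ℤ → ℝ)) := by
    intro t ht
    obtain ⟨k, hk⟩ := key t ht
    refine ⟨k, ?_⟩
    simp only [hk]
    field_simp
  have hd : IsDiscrete (Set.range ((↑) : ℤ → ℝ)) :=
    Int.isClosedEmbedding_coe_real.isEmbedding.isInducing.isDiscrete_range
  obtain ⟨y, -, hy⟩ := isPreconnected_Icc.eqOn_const_of_mapsTo hd hc2 hm ⟨0, 0, by simp⟩
  have e0 := hy (Set.left_mem_Icc.2 hT)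
  have e1 := hy (Set.right_mem_Icc.2 hT)
  simp only [Function.const] at e0 e1
  rw [← e0, div_left_inj' (by positivity)] at e1
  linarith

theorem argVariation_eq {f : ℝ → ℂ} {T δ : ℝ} (hT : 0 ≤ T)
    (hf : ∀ t ∈ Set.Icc 0 T, f t ≠ 0) (h : IsArgVariation f T δ) : argVariation f T = δ :=
  IsArgVariation.unique hT hf (Classical.epsilon_spec ⟨δ, h⟩) h

/-- The only determinants that occur below: the argument grows at the constant speed `ν`. -/
theorem argVariation_const_mul_exp {a : ℂ} (ha : a ≠ 0) (ν : ℝ) {T : ℝ} (hT : 0 ≤ T) :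
    argVariation (fun t => a * Complex.exp ((ν * t : ℝ) * Complex.I)) T = ν * T := by
  refine argVariation_eq hT (fun t _ => mul_ne_zero ha (Complex.exp_ne_zero _))
    ⟨fun t => a.arg + ν * t, by fun_prop, fun t _ => ?_, by simp⟩
  rw [norm_mul, Complex.norm_exp_ofReal_mul_I, mul_one, Complex.ofReal_add, add_mul,
    Complex.exp_add, ← mul_assoc, Complex.norm_mul_exp_arg_mul_I]

theorem graphFrame_realification (M : Matrix (Fin m) (Fin m) ℂ) :
    graphFrame (realification M) =
      Matrix.fromBlocks 1 (-(Complex.I • (1 : Matrix (Fin m) (Fin m) ℂ))) M (Complex.I • M) := by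
  unfold graphFrame realification
  rw [Matrix.fromBlocks_inj]
  refine ⟨rfl, rfl, ?_, ?_⟩ <;> ext i j <;> apply Complex.ext <;> simp

theorem det_graphFrame_realification (M : Matrix (Fin m) (Fin m) ℂ) :
    (graphFrame (realification M)).det = (2 * Complex.I) ^ m * M.det := by
  rw [graphFrame_realification, Matrix.det_fromBlocks_one₁₁]
  have : Complex.I • M - M * -(Complex.I • (1 : Matrix (Fin m) (Fin m) ℂ)) =
      (2 * Complex.I) • M := by
    rw [Matrix.mul_neg, Matrix.mul_smul, Matrix.mul_one, mul_smul, two_smul, sub_neg_eq_add]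
  rw [this, Matrix.det_smul, Fintype.card_fin]

theorem realification_one :
    realification (1 : Matrix (Fin m) (Fin m) ℂ) = 1 := by
  unfold realification
  rw [← Matrix.fromBlocks_one, Matrix.fromBlocks_inj]
  refine ⟨?_, ?_, ?_, ?_⟩ <;> ext i j <;> by_cases h : i = j <;> simp [Matrix.one_apply, h]

/-- The frame is `Z = diag(1, M) C` with `C` constant, and `conj C` is `C` with its blocks of rows
exchanged, so that `Z (conj Z)⁻¹ = diag(1, M) · swap · diag(1, Mᵀ)`. -/
theorem souriau_graphFrame_realification {M : Matrix (Fin m) (Fin m) ℂ}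
    (hM : M ∈ Matrix.unitaryGroup (Fin m) ℂ) :
    souriau (graphFrame (realification M)) = Matrix.fromBlocks 0 Mᵀ M 0 := by
  have h1 : (M.map (starRingEnd ℂ)) * Mᵀ = 1 := by
    have := congrArg Matrix.transpose (Matrix.mem_unitaryGroup_iff.1 hM)
    rwa [Matrix.transpose_mul, Matrix.transpose_one] at this
  have h2 : Mᵀ * (M.map (starRingEnd ℂ)) = 1 := mul_eq_one_comm.1 h1
  have hconj : (graphFrame (realification M)).map (starRingEnd ℂ) =
      Matrix.fromBlocks 1 (Complex.I • (1 : Matrix (Fin m) (Fin m) ℂ)) (M.map (starRingEnd ℂ))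
        (-(Complex.I • M.map (starRingEnd ℂ))) := by
    rw [graphFrame_realification, Matrix.fromBlocks_map, Matrix.fromBlocks_inj]
    refine ⟨?_, ?_, rfl, ?_⟩
    · simp
    · ext i j
      by_cases h : i = j <;> simp [h]
    · ext i j
      simp
  have hmul : graphFrame (realification M) =
      Matrix.fromBlocks 0 Mᵀ M 0 * (graphFrame (realification M)).map (starRingEnd ℂ) := by
    rw [hconj, Matrix.fromBlocks_multiply, graphFrame_realification]
    simp [h2]
  have hunit : IsUnit ((graphFrame (realification M)).map (starRingEnd ℂ)).det := by
    have : ((graphFrame (realification M)).map (starRingEnd ℂ)).det =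
        starRingEnd ℂ (graphFrame (realification M)).det :=
      ((starRingEnd ℂ).map_det _).symm
    have hd : M.det ≠ 0 := by
      intro h0
      have := congrArg Matrix.det (Matrix.mem_unitaryGroup_iff.1 hM)
      rw [Matrix.det_mul, h0, zero_mul, Matrix.det_one] at this
      exact zero_ne_one this
    rw [this, det_graphFrame_realification, isUnit_iff_ne_zero]
    simp [hd]
  unfold souriau
  conv_lhs => enter [1]; rw [hmul]
  rw [Matrix.mul_assoc, Matrix.mul_nonsing_inv _ hunit, Matrix.mul_one]

/-- Relative to the diagonal, every eigenvalue of `M` is counted twice. -/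
theorem relativeSouriau_realification {M : Matrix (Fin m) (Fin m) ℂ}
    (hM : M ∈ Matrix.unitaryGroup (Fin m) ℂ) :
    relativeSouriau (realification M) = Matrix.fromBlocks Mᵀ 0 0 M := by
  unfold relativeSouriau
  rw [← realification_one, souriau_graphFrame_realification hM,
    souriau_graphFrame_realification (one_mem _)]
  have : (Matrix.fromBlocks 0 (1 : Matrix (Fin m) (Fin m) ℂ)ᵀ (1 : Matrix (Fin m) (Fin m) ℂ) 0)⁻¹ =
      Matrix.fromBlocks 0 (1 : Matrix (Fin m) (Fin m) ℂ) 1 0 := by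
    apply Matrix.inv_eq_right_inv
    rw [Matrix.fromBlocks_multiply]
    simp
  rw [this, Matrix.fromBlocks_multiply]
  simp

theorem endCorrection_realification {M : Matrix (Fin m) (Fin m) ℂ}
    (hM : M ∈ Matrix.unitaryGroup (Fin m) ℂ) :
    endCorrection (realification M) = 2 * (M.charpoly.roots.map sawtooth).sum := by
  unfold endCorrection
  rw [relativeSouriau_realification hM, Matrix.charpoly_fromBlocks_zero₁₂,
    Matrix.charpoly_transpose, Polynomial.roots_mul, Multiset.map_add, Multiset.sum_add, two_mul]
  exact mul_ne_zero (Matrix.charpoly_monic M).ne_zero (Matrix.charpoly_monic M).ne_zero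

theorem sawtooth_one : sawtooth 1 = 0 := by simp [sawtooth]

theorem endCorrection_one :
    endCorrection (1 : Matrix (Fin m ⊕ Fin m) (Fin m ⊕ Fin m) ℝ) = 0 := by
  rw [← realification_one, endCorrection_realification (one_mem _), Matrix.charpoly_one,
    ← Polynomial.C_1, Polynomial.roots_pow, Polynomial.roots_X_sub_C, Fintype.card_fin]
  rw [Multiset.map_nsmul, Multiset.map_singleton, sawtooth_one, Multiset.sum_nsmul]
  simp

/-- A path of unitary matrices that starts at the identity and whose determinant rotates with
constant speed `ν` has an index that depends on its end point only: the crossing form never has to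
be examined. -/
theorem czIndex_realification {M : ℝ → Matrix (Fin m) (Fin m) ℂ} {T ν : ℝ} (hT : 0 ≤ T)
    (h0 : M 0 = 1) (hM : M T ∈ Matrix.unitaryGroup (Fin m) ℂ)
    (hdet : ∀ t, (M t).det = Complex.exp ((ν * t : ℝ) * Complex.I)) :
    czIndex (fun t => realification (M t)) T =
      ν * T / π + 2 * ((M T).charpoly.roots.map sawtooth).sum := by
  unfold czIndex
  simp only [det_graphFrame_realification, hdet]
  rw [argVariation_const_mul_exp (pow_ne_zero _ (by simp)) ν hT, endCorrection_realification hM,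
    h0, realification_one, endCorrection_one, sub_zero]

theorem sawtooth_exp {x : ℝ} (h1 : -(2 * π) < x) (h2 : x < 2 * π) :
    sawtooth (Complex.exp (x * Complex.I)) =
      (if 0 < x then 1 / 2 else if x < 0 then -(1 / 2) else 0) - x / (2 * π) := by
  have hπ := Real.pi_pos
  have hone : Complex.exp (x * Complex.I) = 1 → x = 0 := by
    intro h
    obtain ⟨k, hk'⟩ := exists_int_of_exp_eq (y := 0) (by simpa using h)
    have a1 : (-1 : ℝ) < k := by nlinarith
    have a2 : (k : ℝ) < 1 := by nlinarith
    have a1' : (-1 : ℤ) < k := by exact_mod_cast a1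
    have a2' : k < (1 : ℤ) := by exact_mod_cast a2
    have : k = 0 := by omega
    simp [hk', this]
  have harg : ∀ y : ℝ, y ∈ Set.Ioc (-π) π → -Complex.exp (x * Complex.I) =
      Complex.exp (y * Complex.I) → Complex.arg (-Complex.exp (x * Complex.I)) = y := by
    intro y hy h
    rw [h, Complex.arg_exp_mul_I, toIocMod_eq_self]
    simpa [two_mul] using hy
  rcases lt_trichotomy x 0 with h | h | h
  · rw [sawtooth, if_neg (fun h' => h.ne (hone h')), harg (x + π) ⟨by linarith, by linarith⟩,
      if_neg (by linarith), if_pos h]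
    · field_simp
      ring
    · rw [Complex.ofReal_add, add_mul, Complex.exp_add, Complex.exp_pi_mul_I]
      ring
  · simp [h, sawtooth_one]
  · rw [sawtooth, if_neg (fun h' => h.ne' (hone h')), harg (x - π) ⟨by linarith, by linarith⟩,
      if_pos h]
    · field_simp
      ring
    · rw [Complex.ofReal_sub, sub_mul, Complex.exp_sub, Complex.exp_pi_mul_I]
      ring

/-! ### Orthonormal eigenframes -/

theorem exists_orthonormalBasis_cons {E : Type*} [NormedAddCommGroup E] [InnerProductSpace ℂ E]
    [FiniteDimensional ℂ E] {n : ℕ} {z : E} (hz : ‖z‖ = 1)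
    (b : OrthonormalBasis (Fin n) ℂ ((ℂ ∙ z)ᗮ : Submodule ℂ E)) :
    ∃ b' : OrthonormalBasis (Fin (n + 1)) ℂ E, b' 0 = z ∧ ∀ j, b' (Fin.succ j) = b j := by
  let v : Fin (n + 1) → E := Fin.cons z fun j => (b j : E)
  have hv : Orthonormal ℂ v := by
    rw [orthonormal_iff_ite]
    intro i j
    have h1 : ∀ j, inner ℂ z (b j : E) = 0 := fun j =>
      Submodule.mem_orthogonal_singleton_iff_inner_right.1 (b j).2
    have h2 : ∀ j, inner ℂ (b j : E) z = 0 := fun j =>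
      Submodule.mem_orthogonal_singleton_iff_inner_left.1 (b j).2
    have h3 : ∀ i j, inner ℂ (b i : E) (b j : E) = if i = j then 1 else 0 := fun i j => by
      rw [← Submodule.coe_inner]
      exact orthonormal_iff_ite.1 b.orthonormal i j
    refine Fin.cases ?_ (fun i => ?_) i <;> refine Fin.cases ?_ (fun j => ?_) j
    · simp [v, hz]
    · simp [v, h1, (Fin.succ_ne_zero j).symm]
    · simp [v, h2]
    · simp [v, h3]
  have hcard : Module.finrank ℂ E = n + 1 := by
    have h1 := Submodule.finrank_add_finrank_orthogonal (ℂ ∙ z)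
    rw [finrank_span_singleton (by rintro rfl; simp at hz),
      Module.finrank_eq_card_basis b.toBasis, Fintype.card_fin] at h1
    omega
  refine ⟨(basisOfOrthonormalOfCardEqFinrank hv (by simp [hcard])).toOrthonormalBasis
    (by simpa using hv), ?_, fun j => ?_⟩ <;> simp [v]

theorem apply_mem_orthogonal {E : Type*} [NormedAddCommGroup E] [InnerProductSpace ℂ E]
    {T : E →ₗᵢ[ℂ] E} {z : E} {μ : ℂ} (hμ : μ ≠ 0) (hT : T z = μ • z) :
    ∀ w ∈ (ℂ ∙ z)ᗮ, T.toLinearMap w ∈ (ℂ ∙ z)ᗮ := by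
  intro w hw
  rw [Submodule.mem_orthogonal_singleton_iff_inner_right] at hw ⊢
  have h := T.inner_map_map z w
  rw [hT, inner_smul_left, hw] at h
  exact (mul_eq_zero.1 h).resolve_left (by simpa using hμ)

/-- By induction on the dimension, as the orthogonal complement of an eigenvector is invariant. -/
theorem exists_eigenbasis (n : ℕ) : ∀ {E : Type*} [NormedAddCommGroup E] [InnerProductSpace ℂ E]
    [FiniteDimensional ℂ E] (T : E →ₗᵢ[ℂ] E), Module.finrank ℂ E = n →
    ∃ b : OrthonormalBasis (Fin n) ℂ E, ∀ j, ∃ μ : ℂ, T (b j) = μ • b j := by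
  induction n with
  | zero =>
    intro E _ _ _ T h
    exact ⟨(stdOrthonormalBasis ℂ E).reindex (finCongr h), fun j => j.elim0⟩
  | succ n ih =>
    intro E _ _ _ T h
    have : Nontrivial E := Module.nontrivial_of_finrank_pos (R := ℂ) (by omega)
    obtain ⟨μ, hμ⟩ := Module.End.exists_eigenvalue T.toLinearMap
    obtain ⟨v, hv⟩ := hμ.exists_hasEigenvector
    have hv0 : v ≠ 0 := hv.2
    have hTv : T v = μ • v := hv.apply_eq_smul
    obtain ⟨z, hz, hTz⟩ : ∃ z : E, ‖z‖ = 1 ∧ T z = μ • z :=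
      ⟨((‖v‖⁻¹ : ℝ) : ℂ) • v, by simp [norm_smul, hv0], by rw [map_smul, hTv, smul_comm]⟩
    have hμ0 : μ ≠ 0 := by
      rintro rfl
      have := T.norm_map z
      rw [hTz] at this
      simp [hz] at this
    obtain ⟨b, hb⟩ := ih (E := ((ℂ ∙ z)ᗮ : Submodule ℂ E))
      ⟨T.toLinearMap.restrict (apply_mem_orthogonal hμ0 hTz), fun w => T.norm_map w⟩ (by
        have := Fact.mk h
        exact Submodule.finrank_orthogonal_span_singleton (by rintro rfl; simp at hz))
    obtain ⟨b', h0, hs⟩ := exists_orthonormalBasis_cons hz b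
    refine ⟨b', Fin.cases ⟨μ, by rw [h0, hTz]⟩ fun j => ?_⟩
    obtain ⟨ν, hν⟩ := hb j
    exact ⟨ν, by rw [hs]; exact congrArg Subtype.val hν⟩

/-- The action of `A ∈ SU(n)` as a linear isometry. -/
def actₗᵢ (A : SU m) : Cn m →ₗᵢ[ℂ] Cn m where
  toFun := act A
  map_add' v w := by simp [act, Matrix.mulVec_add]
  map_smul' c v := act_smul A c v
  norm_map' := norm_act A

@[simp] theorem actₗᵢ_apply (A : SU m) (v : Cn m) : actₗᵢ A v = act A v := rfl

theorem mem_eigV {g : SU m} {ℓ : ℝ} {v : Cn m} :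
    v ∈ eigV g ℓ ↔ act g v = Complex.exp (ℓ * Complex.I) • v := Iff.rfl

/-- An orthonormal basis `b_0, …, b_m` of `ℂ^n` with `g b_j = e^{ic_j} b_j`.  The angles `c_j` are
taken in `(0, 2π]`, so that `2π - c_j ∈ [0, 2π)` are the angles of `g⁻¹` that occur in the age. -/
structure EigenFrame (g : SU m) where
  basis : OrthonormalBasis (Fin (m + 1)) ℂ (Cn m)
  angle : Fin (m + 1) → ℝ
  angle_mem : ∀ j, angle j ∈ Set.Ioc 0 (2 * π)
  act_basis : ∀ j, act g (basis j) = Complex.exp (angle j * Complex.I) • basis j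

/-- The half-open interval `(0, 2π]` is the range of `2π - a` for `a ∈ [0, 2π)`, as in the age. -/
theorem exists_angle {μ : ℂ} (hμ : ‖μ‖ = 1) :
    ∃ c ∈ Set.Ioc 0 (2 * π), μ = Complex.exp ((c : ℝ) * Complex.I) := by
  refine ⟨toIocMod Real.two_pi_pos 0 μ.arg, by simpa using toIocMod_mem_Ioc Real.two_pi_pos 0 μ.arg,
    ?_⟩
  have h := Complex.norm_mul_exp_arg_mul_I μ
  rw [hμ, Complex.ofReal_one, one_mul] at h
  conv_lhs => rw [← h]
  rw [Complex.exp_eq_exp_iff_exists_int]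
  refine ⟨toIocDiv Real.two_pi_pos 0 μ.arg, ?_⟩
  have h2 := toIocMod_add_toIocDiv_zsmul Real.two_pi_pos 0 μ.arg
  conv_lhs => rw [← h2]
  push_cast [zsmul_eq_mul]
  ring

theorem exists_eigenFrame {g : SU m} {ℓ : ℝ} {z : Cn m} (hz : ‖z‖ = 1) (hg : z ∈ eigV g ℓ) :
    ∃ F : EigenFrame g, F.basis 0 = z := by
  have hfr : Module.finrank ℂ (Cn m) = m + 1 := by simp
  obtain ⟨b, hb⟩ := exists_eigenbasis m (E := ((ℂ ∙ z)ᗮ : Submodule ℂ (Cn m)))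
    ⟨(actₗᵢ g).toLinearMap.restrict (apply_mem_orthogonal (Complex.exp_ne_zero _) hg),
      fun w => norm_act g w⟩ (by
        have := Fact.mk hfr
        exact Submodule.finrank_orthogonal_span_singleton (by rintro rfl; simp at hz))
  obtain ⟨b', h0, hs⟩ := exists_orthonormalBasis_cons hz b
  have key : ∀ j, ∃ c ∈ Set.Ioc 0 (2 * π), act g (b' j) =
      Complex.exp ((c : ℝ) * Complex.I) • b' j := by
    intro j
    obtain ⟨μ, hμ⟩ : ∃ μ : ℂ, act g (b' j) = μ • b' j := by
      refine Fin.cases ⟨_, by rw [h0]; exact hg⟩ (fun j => ?_) j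
      obtain ⟨ν, hν⟩ := hb j
      exact ⟨ν, by rw [hs]; exact congrArg Subtype.val hν⟩
    have hn : ‖μ‖ = 1 := by
      have := norm_act g (b' j)
      rwa [hμ, norm_smul, b'.orthonormal.1, mul_one] at this
    obtain ⟨c, hc, rfl⟩ := exists_angle hn
    exact ⟨c, hc, hμ⟩
  choose c hc hc' using key
  exact ⟨⟨b', c, hc, hc'⟩, h0⟩

/-! ### Age and eigenspaces in an eigenframe -/

theorem toMatrix_eq_diagonal {ι E : Type*} [Fintype ι] [DecidableEq ι] [AddCommGroup E]
    [Module ℂ E] (b : Module.Basis ι ℂ E) (L : E →ₗ[ℂ] E) (μ : ι → ℂ)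
    (h : ∀ j, L (b j) = μ j • b j) : LinearMap.toMatrix b b L = Matrix.diagonal μ := by
  ext i j
  rw [LinearMap.toMatrix_apply, h, map_smul, Finsupp.smul_apply, b.repr_self_apply,
    Matrix.diagonal_apply]
  by_cases hij : i = j
  · simp [hij]
  · simp [hij, Ne.symm hij]

theorem roots_charpoly_of_eigenbasis {ι E : Type*} [Fintype ι] [DecidableEq ι] [AddCommGroup E]
    [Module ℂ E] [FiniteDimensional ℂ E] (b : Module.Basis ι ℂ E) (L : E →ₗ[ℂ] E)
    (μ : ι → ℂ) (h : ∀ j, L (b j) = μ j • b j) :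
    L.charpoly.roots = Finset.univ.val.map μ := by
  rw [← LinearMap.charpoly_toMatrix L b, toMatrix_eq_diagonal b L μ h, Matrix.charpoly_diagonal]
  exact Polynomial.roots_multiset_prod_X_sub_C (Finset.univ.val.map μ) ▸ by
    rw [Multiset.map_map]; rfl

/-- The standard action is given by the matrix itself, so that its characteristic polynomial can be
computed in an eigenbasis. -/
theorem toMatrix_actₗᵢ (A : SU m) :
    LinearMap.toMatrix (EuclideanSpace.basisFun (Fin (m + 1)) ℂ).toBasis
      (EuclideanSpace.basisFun (Fin (m + 1)) ℂ).toBasis (actₗᵢ A).toLinearMap = A.1 := by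
  ext i j
  rw [LinearMap.toMatrix_apply]
  simp [act]

theorem act_inv_eq {A : SU m} {v : Cn m} {a : ℝ} (h : act A v = Complex.exp (a * Complex.I) • v) :
    act A⁻¹ v = Complex.exp ((-a : ℝ) * Complex.I) • v := by
  have h1 : act A⁻¹ (act A v) = v := by rw [← act_mul, inv_mul_cancel, act_one]
  rw [h, act_smul] at h1
  conv_rhs => rw [← h1]
  rw [smul_smul, ← Complex.exp_add]
  simp

theorem exp_inj_of_mem {x y : ℝ} (hx : x ∈ Set.Ioc 0 (2 * π)) (hy : y ∈ Set.Ioc 0 (2 * π))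
    (h : Complex.exp (x * Complex.I) = Complex.exp (y * Complex.I)) : x = y := by
  obtain ⟨k, h4⟩ := exists_int_of_exp_eq h
  have hπ := Real.pi_pos
  have a1 : (-1 : ℝ) < k := by nlinarith [hx.1, hx.2, hy.1, hy.2]
  have a2 : (k : ℝ) < 1 := by nlinarith [hx.1, hx.2, hy.1, hy.2]
  have a1' : (-1 : ℤ) < k := by exact_mod_cast a1
  have a2' : k < (1 : ℤ) := by exact_mod_cast a2
  have : k = 0 := by omega
  simpa [this] using h4

namespace EigenFrame

variable {g : SU m} (F : EigenFrame g)

theorem act_inv_basis (j : Fin (m + 1)) :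
    act g⁻¹ (F.basis j) = Complex.exp ((-F.angle j : ℝ) * Complex.I) • F.basis j :=
  act_inv_eq (F.act_basis j)

theorem roots_charpoly_inv : (g⁻¹).1.charpoly.roots =
    Finset.univ.val.map fun j => Complex.exp ((-F.angle j : ℝ) * Complex.I) := by
  rw [← toMatrix_actₗᵢ g⁻¹, LinearMap.charpoly_toMatrix]
  exact roots_charpoly_of_eigenbasis F.basis.toBasis _ _ fun j => by
    simpa using F.act_inv_basis j

theorem age_eq : age g = ∑ j, (1 - F.angle j / (2 * π)) := by
  unfold age
  rw [F.roots_charpoly_inv, Multiset.map_map]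
  change 1 / (2 * π) * ∑ j, toIcoMod Real.two_pi_pos 0
    (Complex.exp ((-F.angle j : ℝ) * Complex.I)).arg = _
  rw [Finset.mul_sum]
  refine Finset.sum_congr rfl fun j _ => ?_
  have hj := F.angle_mem j
  have h : toIcoMod Real.two_pi_pos 0 (Complex.exp ((-F.angle j : ℝ) * Complex.I)).arg =
      2 * π - F.angle j := by
    rw [toIcoMod_eq_iff, Complex.arg_exp_mul_I]
    refine ⟨⟨by linarith [hj.2], by linarith [hj.1]⟩,
      -toIocDiv Real.two_pi_pos (-π) (-F.angle j) - 1, ?_⟩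
    have := toIocMod_add_toIocDiv_zsmul Real.two_pi_pos (-π) (-F.angle j)
    rw [sub_zsmul, neg_zsmul, one_zsmul]
    linarith
  rw [h]
  field_simp

/-- This is `det g = 1`. -/
theorem exists_sum_angle : ∃ N : ℤ, ∑ j, F.angle j = 2 * π * N := by
  have h1 : LinearMap.det (actₗᵢ g).toLinearMap = 1 := by
    rw [← LinearMap.det_toMatrix (EuclideanSpace.basisFun (Fin (m + 1)) ℂ).toBasis,
      toMatrix_actₗᵢ]
    exact (Matrix.mem_specialUnitaryGroup_iff.1 g.2).2
  rw [← LinearMap.det_toMatrix F.basis.toBasis, toMatrix_eq_diagonal F.basis.toBasis _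
    (fun j => Complex.exp (F.angle j * Complex.I)) (fun j => by simpa using F.act_basis j),
    Matrix.det_diagonal, ← Complex.exp_sum, ← Finset.sum_mul, ← Complex.ofReal_sum] at h1
  obtain ⟨N, hN⟩ := exists_int_of_exp_eq (y := 0) (h1.trans (by simp))
  exact ⟨N, by rw [hN, zero_add]⟩

/-- A vector lies in `V_{g,ℓ}` if it has no component outside the `b_j` with `e^{ic_j} = e^{iℓ}`. -/
theorem mem_eigV_iff (ℓ : ℝ) (v : Cn m) : v ∈ eigV g ℓ ↔ ∀ j, F.basis.repr v j ≠ 0 →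
    Complex.exp (F.angle j * Complex.I) = Complex.exp (ℓ * Complex.I) := by
  have h1 : ∀ j, F.basis.repr (act g v) j =
      Complex.exp (F.angle j * Complex.I) * F.basis.repr v j := by
    intro j
    rw [F.basis.repr_apply_apply, F.basis.repr_apply_apply]
    have h2 := inner_act g (F.basis j) v
    rw [F.act_basis, inner_smul_left, ← Complex.exp_conj] at h2
    rw [← h2, ← mul_assoc, ← Complex.exp_add]
    simp
  rw [mem_eigV, ← F.basis.repr.injective.eq_iff]
  constructor
  · intro h j hj
    have h3 := congrArg (fun x => x.ofLp j) h
    simp only [h1, map_smul, PiLp.smul_apply, smul_eq_mul] at h3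
    exact mul_right_cancel₀ hj h3
  · intro h
    ext j
    rw [h1, map_smul, PiLp.smul_apply, smul_eq_mul]
    by_cases hj : F.basis.repr v j = 0
    · simp [hj]
    · rw [h j hj]

open Classical in
theorem finrank_eigV {ℓ : ℝ} (hℓ : ℓ ∈ Set.Ioc 0 (2 * π)) :
    Module.finrank ℂ (eigV g ℓ) = (Finset.univ.filter fun j => F.angle j = ℓ).card := by
  have hspan : eigV g ℓ = Submodule.span ℂ
      (Set.range fun j : {j // F.angle j = ℓ} => F.basis j) := by
    apply le_antisymm
    · intro v hv
      rw [← F.basis.sum_repr v]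
      refine Submodule.sum_mem _ fun j _ => ?_
      by_cases hj : F.basis.repr v j = 0
      · simp [hj]
      · have h := exp_inj_of_mem (F.angle_mem j) hℓ ((F.mem_eigV_iff ℓ v).1 hv j hj)
        exact Submodule.smul_mem _ _ (Submodule.subset_span ⟨⟨j, h⟩, rfl⟩)
    · rw [Submodule.span_le]
      rintro _ ⟨⟨j, rfl⟩, rfl⟩
      exact F.act_basis j
  rw [hspan, finrank_span_eq_card, Fintype.card_subtype]
  exact (F.basis.orthonormal.linearIndependent).comp _ Subtype.val_injective

open Classical in
/-- Each eigenvalue of `g` is `e^{iℓ'}` for exactly one `ℓ' ∈ (0, 2π]`, its angle in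
the frame. -/
theorem dimBelow_eq {ℓ : ℝ} (hℓ : ℓ ≤ 2 * π) :
    dimBelow g ℓ = (Finset.univ.filter fun j => F.angle j < ℓ).card := by
  unfold dimBelow
  have h1 : ∀ x ∈ Set.Ioo 0 ℓ, Module.finrank ℂ (eigV g x) =
      (Finset.univ.filter fun j => F.angle j = x).card :=
    fun x hx => F.finrank_eigV ⟨hx.1, hx.2.le.trans hℓ⟩
  let s : Finset ℝ := (Finset.univ.filter fun j => F.angle j < ℓ).image F.angle
  rw [finsum_mem_eq_sum_of_inter_support_eq (t := s)]
  · rw [Finset.card_eq_sum_card_fiberwise (t := s) (f := F.angle)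
      (fun j hj => Finset.mem_image_of_mem _ hj), Nat.cast_sum]
    refine Finset.sum_congr rfl fun x hx => ?_
    obtain ⟨j, hj, rfl⟩ := Finset.mem_image.1 hx
    rw [h1 _ ⟨(F.angle_mem j).1, (Finset.mem_filter.1 hj).2⟩, Finset.filter_filter]
    congr 2
    ext i
    simp only [Finset.mem_filter, Finset.mem_univ, true_and]
    constructor
    · intro h
      exact ⟨h ▸ (Finset.mem_filter.1 hj).2, h⟩
    · exact fun h => h.2
  · ext x
    simp only [Set.mem_inter_iff, Function.mem_support, Finset.mem_coe]
    refine and_congr_left fun hx => ?_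
    constructor
    · intro hx'
      rw [h1 x hx'] at hx
      obtain ⟨j, hj⟩ := Finset.card_pos.1 (Nat.pos_of_ne_zero (by exact_mod_cast hx))
      have hj' := (Finset.mem_filter.1 hj).2
      exact Finset.mem_image.2 ⟨j, by simpa [hj'] using hx'.2, hj'⟩
    · intro hx'
      obtain ⟨j, hj, rfl⟩ := Finset.mem_image.1 hx'
      exact ⟨(F.angle_mem j).1, (Finset.mem_filter.1 hj).2⟩

/-- The eigenvalue count behind the index formula.  With `a = 2π - c` the angle of an eigenvalue of
`g⁻¹`, the summand is `1 - a/π - ℓ/π`, raised by `1` if `c = ℓ` and by `2` if `c < ℓ`: the first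
excess counts `dim V_{g,ℓ}`, the second the eigenvalues below `ℓ`. -/
theorem sum_sawtooth {ℓ : ℝ} (hℓ : ℓ ∈ Set.Ioc 0 (2 * π)) :
    ((m + 1 : ℕ) : ℝ) * ℓ / π +
        2 * ∑ j, sawtooth (Complex.exp ((ℓ - F.angle j : ℝ) * Complex.I)) =
      ((m + 1 : ℕ) : ℝ) - 2 * age g + 2 * dimBelow g ℓ + Module.finrank ℂ (eigV g ℓ) := by
  classical
  have h : ∀ j, 2 * sawtooth (Complex.exp ((ℓ - F.angle j : ℝ) * Complex.I)) =
      1 - 2 * (1 - F.angle j / (2 * π)) + 2 * (if F.angle j < ℓ then 1 else 0) +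
        (if F.angle j = ℓ then 1 else 0) - ℓ / π := by
    intro j
    have hj := F.angle_mem j
    rw [sawtooth_exp (by linarith [hj.2, hℓ.1]) (by linarith [hj.1, hℓ.2])]
    rcases lt_trichotomy (F.angle j) ℓ with h | h | h
    · rw [if_pos (by linarith), if_pos h, if_neg h.ne]
      field_simp
      ring
    · rw [if_neg (by linarith), if_neg (by linarith), if_neg (by linarith), if_pos h]
      field_simp
      ring
    · rw [if_neg (by linarith), if_pos (by linarith), if_neg (by linarith), if_neg h.ne']
      field_simp
      ring
  rw [Finset.mul_sum, Finset.sum_congr rfl fun j _ => h j, F.age_eq, F.dimBelow_eq hℓ.2,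
    F.finrank_eigV hℓ, Finset.card_filter, Finset.card_filter]
  simp only [Finset.sum_add_distrib, Finset.sum_sub_distrib, ← Finset.mul_sum, Finset.sum_const,
    Finset.card_univ, Fintype.card_fin, nsmul_eq_mul]
  push_cast
  ring

end EigenFrame

/-! ### The index in a compatible trivialisation -/

theorem rot_mem_xi {z w : Cn m} (t : ℝ) (h : w ∈ xi z) : rot t w ∈ xi (rot t z) := by
  rw [xi, Submodule.mem_orthogonal_singleton_iff_inner_right] at h ⊢
  rw [inner_rot, h]

theorem act_mem_xi {z w : Cn m} (A : SU m) (h : w ∈ xi z) : act A w ∈ xi (act A z) := by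
  rw [xi, Submodule.mem_orthogonal_singleton_iff_inner_right] at h ⊢
  rw [inner_act, h]

theorem rot_add (s t : ℝ) (z : Cn m) : rot (s + t) z = rot s (rot t z) := by
  simp only [rot, smul_smul, ← Complex.exp_add, Complex.ofReal_add, add_mul]

theorem rot_zero (z : Cn m) : rot 0 z = z := by simp [rot]

theorem flowSph_zero (z : Sph m) : flowSph 0 z = z := Subtype.ext (rot_zero z.1)

theorem flowSph_add (s t : ℝ) (z : Sph m) : flowSph (s + t) z = flowSph s (flowSph t z) :=
  Subtype.ext (rot_add s t z.1)

theorem coe_flowSph (t : ℝ) (z : Sph m) : (flowSph t z).1 = rot t z.1 := rfl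

theorem mem_eigV_iff_smul {g : SU m} {ℓ : ℝ} {z : Sph m} :
    z.1 ∈ eigV g ℓ ↔ g • z = flowSph ℓ z :=
  ⟨fun h => Subtype.ext h, fun h => congrArg Subtype.val h⟩

theorem piG_eq_iff {y z : Sph m} : piG G y = piG G z ↔ ∃ h ∈ G, h • y = z := by
  rw [eq_comm]
  refine Quotient.eq.trans ⟨?_, ?_⟩
  · rintro ⟨h, rfl⟩
    exact ⟨h.1, h.2, rfl⟩
  · rintro ⟨h, hh, rfl⟩
    exact ⟨⟨h, hh⟩, rfl⟩

theorem piXi_eq_of_act {x y : Xi m} {h : SU m} (hh : h ∈ G) (hxy : h • x = y) :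
    piXi G x = piXi G y := by
  subst hxy
  exact (Quotient.sound ⟨⟨h, hh⟩, rfl⟩ : piXi G (h • x) = piXi G x).symm

theorem sectionK_rot (t : ℝ) (z : Sph m) (w : Fin m → xi z.1) :
    sectionK (flowSph t z) (fun j => ⟨rot t (w j).1, rot_mem_xi t (w j).2⟩) =
      Complex.exp (((m + 1 : ℕ) * t : ℝ) * Complex.I) * sectionK z w := by
  unfold sectionK
  have h : (Matrix.of (Fin.cons (α := fun _ => Fin (m + 1) → ℂ) (flowSph t z).1.ofLp
      (fun j => (rot t (w j).1).ofLp)) : Matrix (Fin (m + 1)) (Fin (m + 1)) ℂ) =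
      Complex.exp (t * Complex.I) • Matrix.of
        (Fin.cons (α := fun _ => Fin (m + 1) → ℂ) z.1.ofLp (fun j => (w j).1.ofLp)) := by
    ext i j
    refine Fin.cases ?_ (fun i => ?_) i <;> simp [rot, coe_flowSph]
  rw [h, Matrix.det_smul, Fintype.card_fin, ← Complex.exp_nat_mul]
  congr 2
  push_cast
  ring

namespace CompatibleTrivialization

variable {ℓ : ℝ} {γ : ReebOrbit G ℓ} (τ : CompatibleTrivialization γ)

theorem _root_.QuotientCZ.ReebOrbit.piG_flowSph (γ : ReebOrbit G ℓ) {z : Sph m}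
    (hz : piG G z = γ.toFun 0) (t : ℝ) :
    piG G (flowSph t z) = γ.toFun (t : AddCircle ℓ) := by
  rw [γ.flow t, ← hz]
  rfl

theorem toEquiv_congr {s s' : AddCircle ℓ} (h : s = s') {x x' : XiG G} (hx : projG G x = γ.toFun s)
    (hx' : projG G x' = γ.toFun s') (hxx : x = x') :
    τ.toEquiv s ⟨x, hx⟩ = τ.toEquiv s' ⟨x', hx'⟩ := by
  subst h hxx
  rfl

theorem flowMap_fiberMk {z : Sph m} (hz : piG G z = γ.toFun 0) (t : ℝ) (w : xi z.1) :
    τ.flowMap t (τ.toEquiv 0 (fiberMk z hz w)) =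
      τ.toEquiv t (fiberMk (flowSph t z) (γ.piG_flowSph hz t)
        ⟨rot t w.1, rot_mem_xi t w.2⟩) := by
  refine τ.toEquiv_congr rfl _ _ ?_
  rw [Equiv.symm_apply_apply]
  rfl

/-- The return map: as `e^{iℓ} z = g z`, the linearised flow over one period is
`w ↦ e^{iℓ} g⁻¹ w` on `ξ_z`. -/
theorem flowMap_period {g : SU m} (hg : g ∈ G) {z : Sph m} (hz : piG G z = γ.toFun 0)
    (hzg : z.1 ∈ eigV g ℓ) (w w' : xi z.1) (hw : w'.1 = act g⁻¹ (rot ℓ w.1)) :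
    τ.flowMap ℓ (τ.toEquiv 0 (fiberMk z hz w)) = τ.toEquiv 0 (fiberMk z hz w') := by
  rw [τ.flowMap_fiberMk hz]
  refine τ.toEquiv_congr (AddCircle.coe_period ℓ) _ _ (piXi_eq_of_act (inv_mem hg) ?_)
  refine Subtype.ext (Prod.ext ?_ hw.symm)
  change g⁻¹ • flowSph ℓ z = z
  rw [← mem_eigV_iff_smul.1 hzg, inv_smul_smul]

/-- The complex matrix of the linearised Reeb flow. -/
def complexFlowMatrix (t : ℝ) : Matrix (Fin m) (Fin m) ℂ :=
  Matrix.of fun i j => (τ.flowMap t (EuclideanSpace.single j 1)).ofLp i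

/-- Since the trivialisation takes `K_G` to the standard volume form and `K_{e^{it}z}` is built from
`n` vectors each of which the flow multiplies by `e^{it}`, the determinant is `e^{int}`. -/
theorem det_complexFlowMatrix {z : Sph m} (hz : piG G z = γ.toFun 0) (t : ℝ) :
    (τ.complexFlowMatrix t).det = Complex.exp (((m + 1 : ℕ) * t : ℝ) * Complex.I) := by
  obtain ⟨e, he⟩ := τ.unitary 0 z hz
  let w : Fin m → xi z.1 := fun j => e.symm (EuclideanSpace.single j 1)
  have hw : ∀ j, τ.toEquiv 0 (fiberMk z hz (w j)) = EuclideanSpace.single j 1 := fun j => by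
    rw [he, LinearIsometryEquiv.apply_symm_apply]
  have h0 := τ.compatible 0 z hz w
  have ht := τ.compatible t (flowSph t z) (γ.piG_flowSph hz t)
    (fun j => ⟨rot t (w j).1, rot_mem_xi t (w j).2⟩)
  have h1 : (Matrix.of fun j => (τ.toEquiv 0 (fiberMk z hz (w j))).ofLp) =
      (1 : Matrix (Fin m) (Fin m) ℂ) := by
    ext i j
    simp [hw, Matrix.one_apply, Pi.single_apply, eq_comm]
  rw [h1, Matrix.det_one] at h0
  rw [sectionK_rot, h0, mul_one] at ht
  rw [ht, ← Matrix.det_transpose]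
  congr 1
  ext i j
  simp only [complexFlowMatrix, Matrix.transpose_apply, Matrix.of_apply]
  rw [← hw, τ.flowMap_fiberMk hz]

theorem complexFlowMatrix_zero {z : Sph m} (hz : piG G z = γ.toFun 0) :
    τ.complexFlowMatrix 0 = 1 := by
  obtain ⟨e, he⟩ := τ.unitary 0 z hz
  ext i j
  have hw : τ.toEquiv 0 (fiberMk z hz (e.symm (EuclideanSpace.single j 1))) =
      EuclideanSpace.single j 1 := by
    rw [he, LinearIsometryEquiv.apply_symm_apply]
  have h : τ.flowMap 0 (EuclideanSpace.single j 1) = EuclideanSpace.single j 1 := by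
    conv_lhs => rw [← hw]
    rw [τ.flowMap_fiberMk hz]
    refine (τ.toEquiv_congr rfl _ _ (congrArg (piXi G) (Subtype.ext (Prod.ext ?_ ?_)))).trans hw
    · exact flowSph_zero z
    · exact rot_zero _
  simp [complexFlowMatrix, h, Matrix.one_apply]

theorem flowMatrix_eq : τ.flowMatrix = fun t => realification (τ.complexFlowMatrix t) := rfl

/-- The return map has the eigenvalues `e^{i(ℓ - c_j)}`, `j ≥ 1`, if `g` has the eigenvalues
`e^{ic_j}` and the orbit starts at an eigenvector for `e^{ic_0}`. -/
theorem complexFlowMatrix_period [NeZero m] {g : SU m} (hg : g ∈ G) {z : Sph m}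
    (hz : piG G z = γ.toFun 0)
    (hzg : z.1 ∈ eigV g ℓ) (F : EigenFrame g) (hF : F.basis 0 = z.1) :
    τ.complexFlowMatrix ℓ ∈ Matrix.unitaryGroup (Fin m) ℂ ∧
      (τ.complexFlowMatrix ℓ).charpoly.roots = Finset.univ.val.map fun j : Fin m =>
        Complex.exp ((ℓ - F.angle j.succ : ℝ) * Complex.I) := by
  obtain ⟨e, he⟩ := τ.unitary 0 z hz
  have hmem : ∀ w ∈ xi z.1, act g⁻¹ (rot ℓ w) ∈ xi z.1 := by
    intro w hw
    have h := act_mem_xi g⁻¹ (rot_mem_xi ℓ hw)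
    rwa [show act g⁻¹ (rot ℓ z.1) = z.1 by
      rw [rot, ← mem_eigV.1 hzg, ← act_mul, inv_mul_cancel, act_one]] at h
  let S : xi z.1 →ₗᵢ[ℂ] xi z.1 :=
    { toFun := fun w => ⟨act g⁻¹ (rot ℓ w.1), hmem w.1 w.2⟩
      map_add' := fun v w => Subtype.ext (by simp [rot, act, Matrix.mulVec_add])
      map_smul' := fun c w => Subtype.ext (by
        simp only [Submodule.coe_smul, RingHom.id_apply, rot, act_smul]
        rw [smul_comm])
      norm_map' := fun w => by
        change ‖act g⁻¹ (rot ℓ w.1)‖ = ‖w.1‖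
        rw [norm_act, norm_rot] }
  let L : EuclideanSpace ℂ (Fin m) →ₗᵢ[ℂ] EuclideanSpace ℂ (Fin m) :=
    e.toLinearIsometry.comp (S.comp e.symm.toLinearIsometry)
  have hL : ∀ v, τ.flowMap ℓ v = L v := by
    intro v
    have h1 : τ.toEquiv 0 (fiberMk z hz (e.symm v)) = v := by
      rw [he, LinearIsometryEquiv.apply_symm_apply]
    conv_lhs => rw [← h1]
    rw [τ.flowMap_period hg hz hzg (e.symm v) (S (e.symm v)) rfl, he]
    rfl
  have hbasis : ∀ j : Fin m, F.basis j.succ ∈ xi z.1 := by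
    intro j
    rw [xi, Submodule.mem_orthogonal_singleton_iff_inner_right, ← hF]
    exact F.basis.orthonormal.2 (Fin.succ_ne_zero j).symm
  let b : Fin m → EuclideanSpace ℂ (Fin m) := fun j => e ⟨F.basis j.succ, hbasis j⟩
  have hb : Orthonormal ℂ b := by
    rw [orthonormal_iff_ite]
    intro i j
    refine (LinearIsometryEquiv.inner_map_map (𝕜 := ℂ) (E := xi z.1)
      (E' := EuclideanSpace ℂ (Fin m)) e _ _).trans ?_
    rw [Submodule.coe_inner, orthonormal_iff_ite.1 F.basis.orthonormal]
    simp only [Fin.succ_inj]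
  have hLb : ∀ j, L (b j) = Complex.exp ((ℓ - F.angle j.succ : ℝ) * Complex.I) • b j := by
    intro j
    simp only [L, b, LinearIsometry.coe_comp, Function.comp_apply,
      LinearIsometryEquiv.coe_toLinearIsometry, LinearIsometryEquiv.symm_apply_apply]
    rw [← map_smul]
    congr 1
    refine Subtype.ext ?_
    change act g⁻¹ (rot ℓ (F.basis j.succ)) = _ • F.basis j.succ
    rw [rot, act_smul, F.act_inv_basis, smul_smul, ← Complex.exp_add]
    congr 2
    push_cast
    ring
  have hmat : τ.complexFlowMatrix ℓ = LinearMap.toMatrix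
      (EuclideanSpace.basisFun (Fin m) ℂ).toBasis (EuclideanSpace.basisFun (Fin m) ℂ).toBasis
      L.toLinearMap := by
    ext i j
    rw [LinearMap.toMatrix_apply]
    simp [complexFlowMatrix, hL]
  constructor
  · rw [Matrix.mem_unitaryGroup_iff']
    ext j k
    have h1 := L.inner_map_map (EuclideanSpace.single j 1) (EuclideanSpace.single k 1)
    rw [PiLp.inner_apply] at h1
    rw [Matrix.star_eq_conjTranspose, Matrix.mul_apply]
    simp only [Matrix.conjTranspose_apply, complexFlowMatrix, Matrix.of_apply, hL]
    simp only [RCLike.inner_apply] at h1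
    rw [Finset.sum_congr rfl fun i _ => mul_comm _ _]
    refine h1.trans ?_
    rw [EuclideanSpace.inner_single_left]
    simp [Matrix.one_apply]
  · rw [hmat, LinearMap.charpoly_toMatrix]
    refine roots_charpoly_of_eigenbasis (basisOfOrthonormalOfCardEqFinrank hb (by simp)) _ _ ?_
    intro j
    rw [coe_basisOfOrthonormalOfCardEqFinrank]
    exact hLb j

theorem czIndex_flowMatrix [NeZero m] (hℓ : 0 ≤ ℓ) {g : SU m} (hg : g ∈ G) {z : Sph m}
    (hz : piG G z = γ.toFun 0) (hzg : z.1 ∈ eigV g ℓ) (F : EigenFrame g) (hF : F.basis 0 = z.1) :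
    czIndex τ.flowMatrix ℓ = ((m + 1 : ℕ) : ℝ) * ℓ / π +
      2 * ∑ j, sawtooth (Complex.exp ((ℓ - F.angle j : ℝ) * Complex.I)) := by
  obtain ⟨hU, hroots⟩ := τ.complexFlowMatrix_period hg hz hzg F hF
  rw [flowMatrix_eq, czIndex_realification hℓ (τ.complexFlowMatrix_zero hz) hU
    (τ.det_complexFlowMatrix hz), hroots, Multiset.map_map, Fin.sum_univ_succ]
  -- the direction of the orbit itself does not contribute
  have h0 : Complex.exp ((ℓ - F.angle 0 : ℝ) * Complex.I) = 1 := by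
    have h1 := F.act_basis 0
    rw [hF, mem_eigV.1 hzg] at h1
    have h2 := smul_left_injective ℂ (ne_zero_of_mem_unit_sphere z) h1
    rw [Complex.ofReal_sub, sub_mul, Complex.exp_sub, h2, div_self (Complex.exp_ne_zero _)]
  rw [h0, sawtooth_one, zero_add]
  rfl

end CompatibleTrivialization

/-! ### Frames of the contact structure along an orbit -/

theorem act_zpow {g : SU m} {v : Cn m} {a : ℝ} (h : act g v = Complex.exp (a * Complex.I) • v)
    (k : ℤ) : act (g ^ k) v = Complex.exp ((k * a : ℝ) * Complex.I) • v := by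
  have hnat : ∀ n : ℕ, act (g ^ n) v = Complex.exp ((n * a : ℝ) * Complex.I) • v := by
    intro n
    induction n with
    | zero => simp [act_one]
    | succ n ih =>
      rw [pow_succ', act_mul, ih, act_smul, h, smul_smul, ← Complex.exp_add]
      congr 2
      push_cast
      ring
  obtain ⟨n, rfl | rfl⟩ := k.eq_nat_or_neg
  · rw [zpow_natCast, hnat]
    simp
  · rw [zpow_neg, zpow_natCast, act_inv_eq (hnat n)]
    simp

theorem sectionK_act (A : SU m) (z : Sph m) (w : Fin m → xi z.1) :
    sectionK (A • z) (fun j => ⟨act A (w j).1, act_mem_xi A (w j).2⟩) = sectionK z w := by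
  unfold sectionK
  have h : (Matrix.of (Fin.cons (α := fun _ => Fin (m + 1) → ℂ) (A • z).1.ofLp
      (fun j => (act A (w j).1).ofLp)) : Matrix (Fin (m + 1)) (Fin (m + 1)) ℂ) =
      Matrix.of (Fin.cons (α := fun _ => Fin (m + 1) → ℂ) z.1.ofLp (fun j => (w j).1.ofLp)) *
        A.1ᵀ := by
    ext i j
    rw [Matrix.mul_apply]
    refine Fin.cases ?_ (fun i => ?_) i <;>
      simp [coe_smul_sph, act, Matrix.mulVec, dotProduct, mul_comm]
  rw [h, Matrix.det_mul, Matrix.det_transpose, (Matrix.mem_specialUnitaryGroup_iff.1 A.2).2,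
    mul_one]

section Frame

variable (b : OrthonormalBasis (Fin (m + 1)) ℂ (Cn m)) (φ : Fin m → ℝ)

/-- The coordinates with respect to `b_1, …, b_m`, turned by the phases `φ`. -/
def frameMap : Cn m →ₗ[ℂ] EuclideanSpace ℂ (Fin m) where
  toFun w := WithLp.toLp 2 fun j => Complex.exp (φ j * Complex.I) * inner ℂ (b j.succ) w
  map_add' v w := by
    ext j
    simp [mul_add]
  map_smul' c w := by
    ext j
    simp [mul_left_comm]

theorem frameMap_apply (w : Cn m) (j : Fin m) :
    (frameMap b φ w).ofLp j = Complex.exp (φ j * Complex.I) * inner ℂ (b j.succ) w := rfl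

theorem inner_basis_zero {t : ℝ} {w : Cn m} (hw : w ∈ xi (rot t (b 0))) :
    inner ℂ (b 0) w = 0 := by
  rw [xi, Submodule.mem_orthogonal_singleton_iff_inner_right, rot, inner_smul_left] at hw
  exact (mul_eq_zero.1 hw).resolve_left (by simp)

theorem norm_frameMap {t : ℝ} {w : Cn m} (hw : w ∈ xi (rot t (b 0))) :
    ‖frameMap b φ w‖ = ‖w‖ := by
  rw [← b.repr.norm_map w, ← sq_eq_sq₀ (norm_nonneg _) (norm_nonneg _),
    EuclideanSpace.norm_sq_eq, EuclideanSpace.norm_sq_eq, Fin.sum_univ_succ]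
  simp [b.repr_apply_apply, inner_basis_zero b hw, frameMap_apply, Complex.norm_exp_ofReal_mul_I]

/-- If `A y = e^{it} b_0`, then `A` and the coordinates with respect to `b_1, …, b_m` give a unitary
isomorphism of `ξ_y` with `ℂ^m`. -/
def frameIso (A : SU m) (t : ℝ) (y : Sph m) (h : act A y.1 = rot t (b 0)) :
    xi y.1 ≃ₗᵢ[ℂ] EuclideanSpace ℂ (Fin m) :=
  LinearIsometry.toLinearIsometryEquiv
    { toLinearMap := (frameMap b φ ∘ₗ (actₗᵢ A).toLinearMap) ∘ₗ (xi y.1).subtype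
      norm_map' := fun w => by
        change ‖frameMap b φ (act A w.1)‖ = ‖w.1‖
        rw [norm_frameMap b φ (t := t) (h ▸ act_mem_xi A w.2), norm_act] }
    (by
      have hfr : Fact (Module.finrank ℂ (Cn m) = m + 1) := ⟨by simp⟩
      rw [finrank_euclideanSpace_fin]
      exact Submodule.finrank_orthogonal_span_singleton (ne_zero_of_mem_unit_sphere y))

theorem frameIso_apply (A : SU m) (t : ℝ) (y : Sph m) (h : act A y.1 = rot t (b 0))
    (w : xi y.1) : frameIso b φ A t y h w = frameMap b φ (act A w.1) := rfl

/-- The matrix whose rows are the vectors of `b`. -/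
def rowMatrix : Matrix (Fin (m + 1)) (Fin (m + 1)) ℂ := Matrix.of fun i => (b i).ofLp

theorem norm_det_rowMatrix : ‖(rowMatrix b).det‖ = 1 := by
  have h : rowMatrix b ∈ Matrix.unitaryGroup (Fin (m + 1)) ℂ := by
    rw [Matrix.mem_unitaryGroup_iff]
    ext i j
    have h1 := orthonormal_iff_ite.1 b.orthonormal j i
    rw [PiLp.inner_apply] at h1
    rw [Matrix.star_eq_conjTranspose, Matrix.mul_apply, Matrix.one_apply]
    simp only [eq_comm (a := i)]
    exact h1
  have h2 := Matrix.det_of_mem_unitary h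
  exact CStarRing.norm_of_mem_unitary h2

/-- Expansion of the rows of a matrix in the basis `b`. -/
theorem of_eq_mul_rowMatrix (v : Fin (m + 1) → Cn m) :
    (Matrix.of fun i => (v i).ofLp : Matrix (Fin (m + 1)) (Fin (m + 1)) ℂ) =
      (Matrix.of fun i k => inner ℂ (b k) (v i)) * rowMatrix b := by
  ext i j
  rw [Matrix.mul_apply]
  simp only [Matrix.of_apply, rowMatrix]
  conv_lhs => rw [← b.sum_repr (v i)]
  simp [b.repr_apply_apply]

/-- In the splitting `ℂ y ⊕ ξ_y` the matrix defining `K_y` is block triangular, whence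
`K_y (w) = e^{it} det ⟨b_{k+1}, w_j⟩ · det b`; the phases `φ` supply the two factors. -/
theorem sectionK_eq_det_frameMap {t : ℝ} (hφ : Complex.exp ((∑ j, φ j : ℝ) * Complex.I) =
    Complex.exp (t * Complex.I) * (rowMatrix b).det) (y : Sph m) (hy : y.1 = rot t (b 0))
    (w : Fin m → xi y.1) :
    sectionK y w = (Matrix.of fun j => (frameMap b φ (w j).1).ofLp).det := by
  have h1 : (Matrix.of fun j => (frameMap b φ (w j).1).ofLp : Matrix (Fin m) (Fin m) ℂ) =
      (Matrix.of fun i k => inner ℂ (b k.succ) (w i).1) *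
        Matrix.diagonal fun j => Complex.exp (φ j * Complex.I) := by
    ext i j
    rw [Matrix.mul_diagonal, Matrix.of_apply, Matrix.of_apply, frameMap_apply, mul_comm]
  have h2 : (Matrix.of
      (Fin.cons (α := fun _ => Fin (m + 1) → ℂ) y.1.ofLp (fun j => (w j).1.ofLp)) :
        Matrix (Fin (m + 1)) (Fin (m + 1)) ℂ) =
      Matrix.of fun i => ((Fin.cons y.1 fun j => (w j).1 : Fin (m + 1) → Cn m) i).ofLp := by
    ext i j
    refine Fin.cases rfl (fun i => rfl) i
  rw [h1, Matrix.det_mul, Matrix.det_diagonal, ← Complex.exp_sum, ← Finset.sum_mul,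
    ← Complex.ofReal_sum, hφ]
  unfold sectionK
  rw [h2, of_eq_mul_rowMatrix b, Matrix.det_mul, Matrix.det_succ_row_zero, Fin.sum_univ_succ]
  have h00 : inner ℂ (b 0) y.1 = Complex.exp (t * Complex.I) := by
    rw [hy, rot, inner_smul_right, orthonormal_iff_ite.1 b.orthonormal]
    simp
  have h0s : ∀ j : Fin m, inner ℂ (b j.succ) y.1 = 0 := fun j => by
    rw [hy, rot, inner_smul_right, orthonormal_iff_ite.1 b.orthonormal]
    simp
  have hsub : (Matrix.of fun i k => inner ℂ (b k)
      ((Fin.cons y.1 fun j => (w j).1 : Fin (m + 1) → Cn m) i)).submatrix Fin.succ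
        (Fin.succAbove 0) = Matrix.of fun i k => inner ℂ (b k.succ) (w i).1 := by
    ext i j
    simp
  rw [hsub]
  simp only [Matrix.of_apply, Fin.cons_zero, h00, h0s, mul_zero, zero_mul, Finset.sum_const_zero]
  simp
  ring

end Frame

/-- Phases along the orbit: they turn by the angles of `g⁻¹` over a period, and their sum makes the
frame compatible with `K`.  The first condition fixes the slope of each phase up
to a multiple of `2π/ℓ`; as `det g = 1`, the sum of the slopes then misses the value `1` that the
second condition asks for by such a multiple, which the first phase absorbs. -/
theorem exists_phase [NeZero m] {g : SU m} (F : EigenFrame g) {ℓ : ℝ} (hℓ : ℓ ≠ 0)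
    (hF : F.basis 0 ∈ eigV g ℓ) :
    ∃ φ : ℝ → Fin m → ℝ, Continuous φ ∧
      (∀ t (k : ℤ) j, Complex.exp (φ (t + k * ℓ) j * Complex.I) =
        Complex.exp (φ t j * Complex.I) *
          Complex.exp ((-(k * F.angle j.succ) : ℝ) * Complex.I)) ∧
      ∀ t, Complex.exp ((∑ j, φ t j : ℝ) * Complex.I) =
        Complex.exp (t * Complex.I) * (rowMatrix F.basis).det := by
  obtain ⟨N, hN⟩ := F.exists_sum_angle
  obtain ⟨M, hM⟩ : ∃ M : ℤ, F.angle 0 = ℓ + 2 * π * M := by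
    have h1 := F.act_basis 0
    rw [mem_eigV.1 hF] at h1
    have h2 := smul_left_injective ℂ (F.basis.orthonormal.ne_zero 0) h1
    exact exists_int_of_exp_eq h2.symm
  rw [Fin.sum_univ_succ, hM] at hN
  -- the correction that makes the phases grow by `ℓ` in total over a period
  let a : Fin m → ℤ := Pi.single 0 (N - M)
  -- the constant that normalises the determinant of the basis
  let κ : Fin m → ℝ := Pi.single 0 (rowMatrix F.basis).det.arg
  refine ⟨fun t j => (-F.angle j.succ + 2 * π * a j) / ℓ * t + κ j, by fun_prop, ?_, ?_⟩
  · intro t k j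
    rw [← Complex.exp_add, Complex.exp_eq_exp_iff_exists_int]
    refine ⟨k * a j, ?_⟩
    have h : (-F.angle j.succ + 2 * π * a j) / ℓ * (t + k * ℓ) + κ j =
        (-F.angle j.succ + 2 * π * a j) / ℓ * t + κ j + -(k * F.angle j.succ) +
          k * a j * (2 * π) := by
      field_simp
      ring
    beta_reduce
    rw [h]
    push_cast
    ring
  · intro t
    have ha : ∑ j, (a j : ℝ) = N - M := by
      rw [← Int.cast_sum, Finset.sum_pi_single']
      simp
    have hκ : ∑ j, κ j = (rowMatrix F.basis).det.arg := by
      rw [Finset.sum_pi_single']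
      simp
    have h : ∑ j, ((-F.angle j.succ + 2 * π * a j) / ℓ * t + κ j) =
        t + (rowMatrix F.basis).det.arg := by
      rw [Finset.sum_add_distrib, hκ, ← Finset.sum_mul, ← Finset.sum_div, Finset.sum_add_distrib,
        Finset.sum_neg_distrib, ← Finset.mul_sum, ha,
        show -∑ j, F.angle (Fin.succ j) + 2 * π * ((N : ℝ) - M) = ℓ by linarith, div_self hℓ,
        one_mul]
    rw [h, Complex.ofReal_add, add_mul, Complex.exp_add]
    congr 1
    have := Complex.norm_mul_exp_arg_mul_I (rowMatrix F.basis).det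
    rwa [norm_det_rowMatrix, Complex.ofReal_one, one_mul] at this

/-! ### Existence of compatible trivialisations -/

theorem eq_of_smul_eq (hG : ActsFreely G) {h h' : SU m} (hh : h ∈ G) (hh' : h' ∈ G) {z : Sph m}
    (hz : h • z = h' • z) : h = h' := by
  by_contra hne
  refine hG (h'⁻¹ * h) (G.mul_mem (G.inv_mem hh') hh) (fun h1 => hne (inv_mul_eq_one.1 h1).symm)
    z.1 (ne_zero_of_mem_unit_sphere z) ?_
  rw [act_mul]
  have h2 := congrArg (fun y : Sph m => (h'⁻¹ • y).1) hz
  simpa [coe_smul_sph, ← act_mul, act_one] using h2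

theorem fiberMk_bijective (hG : ActsFreely G) {p : SG G} (z : Sph m) (hz : piG G z = p) :
    Function.Bijective (fiberMk z hz) := by
  constructor
  · intro w w' h
    have h1 : piXi G ⟨(z, w.1), w.2⟩ = piXi G ⟨(z, w'.1), w'.2⟩ := congrArg Subtype.val h
    obtain ⟨A, hA⟩ := Quotient.exact h1
    have hA' : (A.1 • (⟨(z, w'.1), w'.2⟩ : Xi m)) = ⟨(z, w.1), w.2⟩ := hA
    have h2 : A.1 • z = (1 : SU m) • z := by
      rw [one_smul]
      exact congrArg (fun x : Xi m => x.1.1) hA'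
    have h3 : act A.1 w'.1 = w.1 := congrArg (fun x : Xi m => x.1.2) hA'
    rw [eq_of_smul_eq hG A.2 G.one_mem h2, act_one] at h3
    exact Subtype.ext h3.symm
  · rintro ⟨x, hx⟩
    induction x using Quotient.inductionOn with
    | h x =>
      obtain ⟨A, hA, hAz⟩ := piG_eq_iff.1 (hx.trans hz.symm : piG G x.1.1 = piG G z)
      have hw : act A x.1.2 ∈ xi z.1 := by
        rw [← hAz]
        exact act_mem_xi A x.2
      refine ⟨⟨act A x.1.2, hw⟩, Subtype.ext ?_⟩
      exact (piXi_eq_of_act (y := ⟨(z, act A x.1.2), hw⟩) hA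
        (Subtype.ext (Prod.ext hAz rfl))).symm

/-- A representative `z` of `p` identifies `ξ_z` with the fibre of `ξ_G` over `p`. -/
def fiberEquiv (hG : ActsFreely G) {p : SG G} (z : Sph m) (hz : piG G z = p) :
    xi z.1 ≃ Fiber G p := Equiv.ofBijective (fiberMk z hz) (fiberMk_bijective hG z hz)

theorem continuous_act (A : SU m) : Continuous (act A) := (actₗᵢ A).continuous

theorem continuous_smul_sph (A : SU m) : Continuous fun z : Sph m => A • z :=
  ((continuous_act A).comp continuous_subtype_val).subtype_mk _

instance : ContinuousConstSMul G (Xi m) where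
  continuous_const_smul A := by
    refine Continuous.subtype_mk (f := fun x : Xi m => (A.1 • x.1.1, act A.1 x.1.2)) ?_ _
    exact ((continuous_smul_sph A.1).comp (continuous_fst.comp continuous_subtype_val)).prodMk
      ((continuous_act A.1).comp (continuous_snd.comp continuous_subtype_val))

theorem continuous_flowSph (z : Sph m) : Continuous fun t : ℝ => flowSph t z :=
  Continuous.subtype_mk (f := fun t : ℝ => rot t z.1)
    (by unfold rot; fun_prop) _

theorem continuous_frameMap (b : OrthonormalBasis (Fin (m + 1)) ℂ (Cn m)) {X : Type*}
    [TopologicalSpace X] {φ : X → Fin m → ℝ} (hφ : Continuous φ) {w : X → Cn m}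
    (hw : Continuous w) : Continuous fun x => frameMap b (φ x) (w x) := by
  refine (PiLp.continuous_toLp 2 _).comp (continuous_pi fun j => ?_)
  have := (continuous_apply j).comp hφ
  simp only [Function.comp_def] at this
  fun_prop

/-- A map on the total space of `γ^* ξ_G` is continuous if it is so on the pull-back along
`ℝ × ξ → (ℝ/ℓℤ) × ξ_G`, which is an open quotient map. -/
theorem continuous_of_comp_quotient {ℓ : ℝ} (S : Set (AddCircle ℓ × XiG G)) {Y : Type*}
    [TopologicalSpace Y] (f : S → Y)
    (hf : Continuous fun x : {x : ℝ × Xi m // ((x.1 : AddCircle ℓ), piXi G x.2) ∈ S} =>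
      f ⟨((x.1.1 : AddCircle ℓ), piXi G x.1.2), x.2⟩) : Continuous f := by
  let q : ℝ × Xi m → AddCircle ℓ × XiG G := fun x => ((x.1 : AddCircle ℓ), piXi G x.2)
  have hq : IsOpenQuotientMap q :=
    IsOpenQuotientMap.prodMap (QuotientAddGroup.isOpenQuotientMap_mk)
      (MulAction.isOpenQuotientMap_quotientMk (Γ := G) (T := Xi m))
  have hqS : IsOpenQuotientMap (S.restrictPreimage q) :=
    ⟨hq.surjective.restrictPreimage S, hq.continuous.restrictPreimage,
      hq.isOpenMap.restrictPreimage S⟩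
  exact hqS.continuous_comp_iff.1 hf

/-- The frame `b_1, …, b_m` of eigenvectors of `g`, turned by the phases of `exists_phase`, descends
to a compatible trivialisation. -/
theorem nonempty_compatibleTrivialization [NeZero m] [Finite G] (hG : ActsFreely G) {ℓ : ℝ}
    (hℓ : ℓ ≠ 0) {γ : ReebOrbit G ℓ} {g : SU m} (hg : g ∈ G) {z : Sph m}
    (hz : piG G z = γ.toFun 0) (hzg : z.1 ∈ eigV g ℓ) : Nonempty (CompatibleTrivialization γ) := by
  obtain ⟨F, hF⟩ := exists_eigenFrame (mem_sphere_zero_iff_norm.1 z.2) hzg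
  obtain ⟨φ, hφc, hφ, hφsum⟩ := exists_phase F hℓ (hF ▸ hzg)
  -- `T s` is a real representative of `s`; it cannot depend continuously on `s`
  choose T hT using fun s : AddCircle ℓ => QuotientAddGroup.mk_surjective s
  have hact : ∀ t, act 1 (flowSph t z).1 = rot t (F.basis 0) := fun t => by
    rw [act_one, hF, coe_flowSph]
  have hTs : ∀ s, piG G (flowSph (T s) z) = γ.toFun s := fun s =>
    (γ.piG_flowSph hz (T s)).trans (congrArg γ.toFun (hT s))
  let τ : ∀ s, Fiber G (γ.toFun s) ≃ EuclideanSpace ℂ (Fin m) := fun s =>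
    (fiberEquiv hG (flowSph (T s) z) (hTs s)).symm.trans
      (frameIso F.basis (φ (T s)) 1 (T s) _ (hact _)).toEquiv
  -- the formula for `τ` in terms of any representative of a point of `γ^* ξ_G`
  have key : ∀ (s : AddCircle ℓ) (t : ℝ), (t : AddCircle ℓ) = s → ∀ (y : Sph m)
      (hy : piG G y = γ.toFun s) (h : SU m), h ∈ G → h • y = flowSph t z → ∀ w : xi y.1,
      τ s (fiberMk y hy w) = frameMap F.basis (φ t) (act h w.1) := by
    intro s t hts y hy h hh hhy w
    obtain ⟨k, hk⟩ : ∃ k : ℤ, t = T s + k * ℓ := by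
      have h1 : ((t - T s : ℝ) : AddCircle ℓ) = 0 := by
        rw [AddCircle.coe_sub, hts]
        exact sub_eq_zero.2 (hT s).symm
      obtain ⟨k, hk⟩ := AddCircle.coe_eq_zero_iff ℓ |>.1 h1
      exact ⟨k, by rw [zsmul_eq_mul] at hk; linarith⟩
    have hgk : g ^ k • flowSph (T s) z = flowSph t z := by
      rw [← flowSph_smul, hk, flowSph_add]
      congr 1
      exact Subtype.ext (act_zpow hzg k)
    have hA : ((g ^ k)⁻¹ * h) • y = flowSph (T s) z := by
      rw [mul_smul, hhy, ← hgk, inv_smul_smul]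
    have hmem : act ((g ^ k)⁻¹ * h) w.1 ∈ xi (flowSph (T s) z).1 := by
      rw [← hA]
      exact act_mem_xi _ w.2
    have hfib : fiberMk y hy w = fiberEquiv hG (flowSph (T s) z) (hTs s) ⟨_, hmem⟩ :=
      Subtype.ext (piXi_eq_of_act (G.mul_mem (G.inv_mem (G.zpow_mem hg k)) hh)
        (Subtype.ext (Prod.ext hA rfl)))
    rw [hfib]
    simp only [τ, Equiv.trans_apply, Equiv.symm_apply_apply]
    change frameMap F.basis (φ (T s)) (act 1 (act ((g ^ k)⁻¹ * h) w.1)) = _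
    ext j
    rw [act_one, frameMap_apply, frameMap_apply, hk, hφ, act_mul,
      ← inner_act (g ^ k) (F.basis j.succ), ← act_mul (g ^ k), mul_inv_cancel, act_one,
      act_zpow (F.act_basis j.succ), inner_smul_left, ← Complex.exp_conj, mul_assoc]
    simp
  have hrep : ∀ (s : AddCircle ℓ) (y : Sph m), piG G y = γ.toFun s →
      ∃ h ∈ G, h • y = flowSph (T s) z := fun s y hy =>
    piG_eq_iff.1 (hy.trans (hTs s).symm)
  refine ⟨⟨τ, ?_, ?_, ?_⟩⟩
  · refine continuous_of_comp_quotient {x | projG G x.2 = γ.toFun x.1}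
      (fun x => τ x.1.1 ⟨x.1.2, x.2⟩) ?_
    -- the finite closed cover by the sets where a fixed `h ∈ G` moves the base point to `e^{it} z`
    refine LocallyFinite.continuous (f := fun h : G =>
      {x | h.1 • x.1.2.1.1 = flowSph x.1.1 z}) (locallyFinite_of_finite _) ?_ ?_ ?_
    · refine Set.eq_univ_of_forall fun x => Set.mem_iUnion.2 ?_
      obtain ⟨h, hh, hhx⟩ := piG_eq_iff.1
        ((x.2 : piG G x.1.2.1.1 = γ.toFun x.1.1).trans (γ.piG_flowSph hz x.1.1).symm)
      exact ⟨⟨h, hh⟩, hhx⟩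
    · intro h
      refine isClosed_eq ((continuous_smul_sph h.1).comp ?_) ((continuous_flowSph z).comp ?_) <;>
        fun_prop
    · intro h
      have hc : Continuous fun x : {x : ℝ × Xi m //
          ((x.1 : AddCircle ℓ), piXi G x.2) ∈ {x | projG G x.2 = γ.toFun x.1}} =>
          frameMap F.basis (φ x.1.1) (act h.1 x.1.2.1.2) :=
        continuous_frameMap _ (hφc.comp (by fun_prop)) ((continuous_act h.1).comp (by fun_prop))
      refine hc.continuousOn.congr fun x hx => ?_
      exact key x.1.1 x.1.1 rfl x.1.2.1.1 x.2 h.1 h.2 hx ⟨x.1.2.1.2, x.1.2.2⟩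
  · intro s y hy
    obtain ⟨h, hh, hhy⟩ := hrep s y hy
    refine ⟨frameIso F.basis (φ (T s)) h (T s) y ?_, fun w => ?_⟩
    · rw [← coe_smul_sph, hhy, coe_flowSph, hF]
    · rw [key s (T s) (hT s) y hy h hh hhy w, frameIso_apply]
  · intro s y hy w
    obtain ⟨h, hh, hhy⟩ := hrep s y hy
    rw [← sectionK_act h, sectionK_eq_det_frameMap F.basis (φ (T s)) (hφsum _) (h • y)
      (by rw [hhy, hF, coe_flowSph])]
    simp only [key s (T s) (hT s) y hy h hh hhy]

/-! ### The dimension of the families -/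

theorem conj_mem_eigV_iff {g h : SU m} {ℓ : ℝ} {v : Cn m} :
    v ∈ eigV (h⁻¹ * g * h) ℓ ↔ act h v ∈ eigV g ℓ := by
  rw [mem_eigV, mem_eigV, act_mul, act_mul, ← act_smul]
  constructor
  · intro hv
    rw [← hv, ← act_mul h, mul_inv_cancel, act_one]
  · intro hv
    rw [hv, ← act_mul, inv_mul_cancel, act_one]

theorem finrank_eigV_conj (g h : SU m) (ℓ : ℝ) :
    Module.finrank ℂ (eigV (h⁻¹ * g * h) ℓ) = Module.finrank ℂ (eigV g ℓ) := by
  have hmap : (eigV (h⁻¹ * g * h) ℓ).map (actₗᵢ h).toLinearMap = eigV g ℓ := by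
    ext v
    rw [Submodule.mem_map]
    constructor
    · rintro ⟨w, hw, rfl⟩
      exact conj_mem_eigV_iff.1 hw
    · intro hv
      have h1 : act h (act h⁻¹ v) = v := by rw [← act_mul, mul_inv_cancel, act_one]
      exact ⟨act h⁻¹ v, conj_mem_eigV_iff.2 (by rwa [h1]), h1⟩
  rw [← hmap]
  exact (Submodule.equivMapOfInjective _ (actₗᵢ h).injective _).finrank_eq

/-- The preimage of `B_{g,ℓ}` is the union of the unit spheres of the eigenspaces `V_{h⁻¹gh,ℓ}`. -/
theorem mem_preimageG_familyB {g : SU m} {ℓ : ℝ} {z : Cn m} :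
    z ∈ preimageG (familyB G g ℓ) ↔
      z ∈ Sph m ∧ ∃ h ∈ G, z ∈ eigV (h⁻¹ * g * h) ℓ := by
  constructor
  · rintro ⟨hz, y, hy, hyz⟩
    obtain ⟨h, hh, hhz⟩ := piG_eq_iff.1 hyz.symm
    refine ⟨hz, h, hh, conj_mem_eigV_iff.2 ?_⟩
    have : act h z = y.1 := congrArg Subtype.val hhz
    rwa [this]
  · rintro ⟨hz, h, hh, hhz⟩
    exact ⟨hz, h • ⟨z, hz⟩, conj_mem_eigV_iff.1 hhz, (piG_eq_iff.2 ⟨h, hh, rfl⟩).symm⟩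

/-- The tangent space of the unit sphere of a complex subspace `W` at `z` is the real orthogonal
complement of `z` in `W`. -/
theorem span_tangentConeAt_inter_sphere (W : Submodule ℂ (Cn m)) {z : Cn m} (hz : z ∈ Sph m)
    (hzW : z ∈ W) :
    Submodule.span ℝ (tangentConeAt ℝ (Sph m ∩ W) z) = (ℝ ∙ z)ᗮ ⊓ W.restrictScalars ℝ := by
  have hz1 : ‖z‖ = 1 := mem_sphere_zero_iff_norm.1 hz
  apply le_antisymm
  · rw [Submodule.span_le]
    intro w hw
    -- the derivative of a map that is constant on `Sph m ∩ W` kills the tangent directions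
    have hconst : ∀ {E' : Type} [NormedAddCommGroup E'] [NormedSpace ℝ E'] (f : Cn m → E')
        (f' : Cn m →L[ℝ] E') (c : E'), HasFDerivAt f f' z → (∀ x ∈ Sph m ∩ W, f x = c) →
        f' w = 0 := by
      intro E' _ _ f f' c hf hc
      have h1 := (hf.hasFDerivWithinAt (s := Sph m ∩ W)).mapsTo_tangent_cone hw
      have h2 : f '' (Sph m ∩ W) ⊆ {c} := by
        rintro _ ⟨x, hx, rfl⟩
        exact hc x hx
      have h3 := tangentConeAt_mono (𝕜 := ℝ) h2 h1
      exact tangentConeAt_subset_zero (by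
        rw [hc z ⟨hz, hzW⟩]
        intro h
        obtain ⟨y, hne, hy⟩ := (accPt_iff_frequently.1 h).exists
        exact hne hy) h3
    constructor
    · rw [SetLike.mem_coe, Submodule.mem_orthogonal_singleton_iff_inner_right]
      have h1 := hconst (fun x : Cn m => ‖x‖ ^ 2) _ 1
        (hasStrictFDerivAt_norm_sq z).hasFDerivAt (fun x hx => by
          rw [mem_sphere_zero_iff_norm.1 hx.1, one_pow])
      simpa using h1
    · have h1 := hconst (fun x : Cn m => (Wᗮ).starProjection x)
        ((Wᗮ).starProjection.restrictScalars ℝ) 0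
        ((Wᗮ).starProjection.restrictScalars ℝ).hasFDerivAt (fun x hx => by
          rw [Submodule.starProjection_apply_eq_zero_iff, Submodule.orthogonal_orthogonal]
          exact hx.2)
      have h2 : (Wᗮ).starProjection w = 0 := h1
      rw [Submodule.starProjection_apply_eq_zero_iff, Submodule.orthogonal_orthogonal] at h2
      exact h2
  · have hunit : ∀ u ∈ (ℝ ∙ z)ᗮ ⊓ W.restrictScalars ℝ, ‖u‖ = 1 →
        u ∈ tangentConeAt ℝ (Sph m ∩ W) z := by
      rintro u ⟨hu, huW⟩ hu1
      rw [SetLike.mem_coe, Submodule.mem_orthogonal_singleton_iff_inner_right] at hu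
      -- the great circle through `z` with direction `u`
      let c : ℝ → Cn m := fun t => Real.cos t • z + Real.sin t • u
      have hc : HasDerivAt c u 0 := by
        have := ((Real.hasDerivAt_cos 0).smul_const z).add ((Real.hasDerivAt_sin 0).smul_const u)
        refine HasDerivAt.congr_deriv (f := c) this ?_
        simp
      have hrange : c '' Set.univ ⊆ Sph m ∩ W := by
        rintro _ ⟨t, -, rfl⟩
        constructor
        · rw [mem_sphere_zero_iff_norm, ← sq_eq_sq₀ (norm_nonneg _) zero_le_one,
            norm_add_sq_real, inner_smul_left, inner_smul_right, hu, norm_smul, norm_smul, hz1, hu1]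
          simp
        · exact W.add_mem ((W.restrictScalars ℝ).smul_mem _ hzW)
            ((W.restrictScalars ℝ).smul_mem _ huW)
      have h1 := (hc.hasFDerivAt.hasFDerivWithinAt (s := Set.univ)).mapsTo_tangent_cone
        (by rw [tangentConeAt_univ]; exact Set.mem_univ (1 : ℝ))
      have h2 := tangentConeAt_mono (𝕜 := ℝ) hrange h1
      simpa [c] using h2
    intro w hw
    by_cases hw0 : w = 0
    · rw [hw0]
      exact Submodule.zero_mem _
    · have h1 : w = ‖w‖ • (‖w‖⁻¹ • w) := by
        rw [smul_smul, mul_inv_cancel₀ (norm_ne_zero_iff.2 hw0), one_smul]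
      rw [h1]
      refine Submodule.smul_mem _ _ (Submodule.subset_span (hunit _ (Submodule.smul_mem _ _ hw) ?_))
      rw [norm_smul, norm_inv, norm_norm, inv_mul_cancel₀ (norm_ne_zero_iff.2 hw0)]

theorem finrank_tangent_inter_sphere (W : Submodule ℂ (Cn m)) {z : Cn m} (hz : z ∈ Sph m)
    (hzW : z ∈ W) :
    1 + Module.finrank ℝ (Submodule.span ℝ (tangentConeAt ℝ (Sph m ∩ W) z)) =
      2 * Module.finrank ℂ W := by
  have h1 := finrank_span_singleton (K := ℝ) (ne_zero_of_mem_unit_sphere (⟨z, hz⟩ : Sph m))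
  rw [span_tangentConeAt_inter_sphere W hz hzW, ← finrank_real_of_complex]
  refine (congrArg (· + _) h1.symm).trans ?_
  refine Submodule.finrank_add_inf_finrank_orthogonal (𝕜 := ℝ) (K₂ := W.restrictScalars ℝ) ?_
  rw [Submodule.span_singleton_le_iff_mem]
  exact hzW

/-- As `G` acts freely, the eigenspaces `V_{h⁻¹gh,ℓ}`, `h ∈ G`, meet only in `0` unless they are
equal; so near each of its points the preimage of `B_{g,ℓ}` is the unit sphere of one of them. -/
theorem tangentConeAt_preimageG [Finite G] (hG : ActsFreely G) {g : SU m} (hg : g ∈ G) {ℓ : ℝ}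
    {z : Cn m} (hz : z ∈ Sph m) {h : SU m} (hh : h ∈ G) (hzh : z ∈ eigV (h⁻¹ * g * h) ℓ) :
    tangentConeAt ℝ (preimageG (familyB G g ℓ)) z =
      tangentConeAt ℝ (Sph m ∩ eigV (h⁻¹ * g * h) ℓ) z := by
  let U : Set (Cn m) := (⋃ A ∈ {A : G | A.1 ≠ h⁻¹ * g * h}, (eigV A.1 ℓ : Set (Cn m)))ᶜ
  have hU : U ∈ nhds z := by
    refine IsOpen.mem_nhds ?_ ?_
    · exact ((Set.toFinite _).isClosed_biUnion fun A _ =>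
        (eigV A.1 ℓ).closed_of_finiteDimensional).isOpen_compl
    · simp only [U, Set.mem_compl_iff, Set.mem_iUnion, not_exists]
      intro A hA hzA
      refine hA (eq_of_smul_eq (z := ⟨z, hz⟩) hG A.2
        (G.mul_mem (G.mul_mem (G.inv_mem hh) hg) hh) ?_)
      rw [mem_eigV_iff_smul.1 hzA, mem_eigV_iff_smul.1 hzh]
  rw [← tangentConeAt_inter_nhds hU, ← tangentConeAt_inter_nhds (s := Sph m ∩ _) hU]
  congr 1
  ext y
  simp only [Set.mem_inter_iff, mem_preimageG_familyB, SetLike.mem_coe]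
  refine and_congr_left fun hyU => and_congr_right fun _ => ⟨?_, fun hy => ⟨h, hh, hy⟩⟩
  rintro ⟨k, hk, hy⟩
  by_cases hkh : k⁻¹ * g * k = h⁻¹ * g * h
  · rwa [hkh] at hy
  · exact absurd (Set.mem_biUnion (x := (⟨_, G.mul_mem (G.mul_mem (G.inv_mem hk) hg) hk⟩ : G))
      (t := fun A : G => (eigV A.1 ℓ : Set (Cn m))) hkh hy) hyU

theorem exists_unit_mem_eigV {g : SU m} {ℓ : ℝ} (hV : eigV g ℓ ≠ ⊥) :
    ∃ z : Sph m, z.1 ∈ eigV g ℓ := by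
  obtain ⟨v, hv, hv0⟩ := Submodule.exists_mem_ne_zero_of_ne_bot hV
  refine ⟨⟨((‖v‖⁻¹ : ℝ) : ℂ) • v, ?_⟩, Submodule.smul_mem _ _ hv⟩
  rw [mem_sphere_zero_iff_norm]
  simp [norm_smul, hv0]

/-- The dimension of `B_{g,ℓ}` is that of the unit sphere of `V_{g,ℓ}`. -/
theorem realDim_familyB [Finite G] (hG : ActsFreely G) {g : SU m} (hg : g ∈ G) {ℓ : ℝ}
    (hV : eigV g ℓ ≠ ⊥) :
    (realDim (familyB G g ℓ) : ℝ) = 2 * Module.finrank ℂ (eigV g ℓ) - 1 := by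
  have key : ∀ z ∈ preimageG (familyB G g ℓ), 1 + Module.finrank ℝ (Submodule.span ℝ
      (tangentConeAt ℝ (preimageG (familyB G g ℓ)) z)) = 2 * Module.finrank ℂ (eigV g ℓ) := by
    intro z hz
    obtain ⟨hzS, h, hh, hzh⟩ := mem_preimageG_familyB.1 hz
    rw [tangentConeAt_preimageG hG hg hzS hh hzh, finrank_tangent_inter_sphere _ hzS hzh,
      finrank_eigV_conj]
  obtain ⟨z, hz⟩ := exists_unit_mem_eigV hV
  have hz' : z.1 ∈ preimageG (familyB G g ℓ) := ⟨z.2, z, hz, rfl⟩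
  have hset : {d | ∃ z ∈ preimageG (familyB G g ℓ), d = Module.finrank ℝ (Submodule.span ℝ
      (tangentConeAt ℝ (preimageG (familyB G g ℓ)) z))} =
      {2 * Module.finrank ℂ (eigV g ℓ) - 1} := by
    ext d
    simp only [Set.mem_ofPred_eq, Set.mem_singleton_iff]
    constructor
    · rintro ⟨y, hy, rfl⟩
      have := key y hy
      omega
    · rintro rfl
      have := key z.1 hz'
      exact ⟨z.1, hz', by omega⟩
  have hpos : 1 ≤ 2 * Module.finrank ℂ (eigV g ℓ) := by
    have := key z.1 hz'
    omega
  unfold realDim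
  rw [hset, csSup_singleton, Nat.cast_sub hpos]
  push_cast
  ring

/-! ### The index of the families -/

/-- The Reeb orbit `t ↦ [e^{it} z]` of length `ℓ`, for `g z = e^{iℓ} z`. -/
def orbitOfEigenvector {g : SU m} (hg : g ∈ G) {ℓ : ℝ} {z : Sph m} (hz : z.1 ∈ eigV g ℓ) :
    ReebOrbit G ℓ where
  toFun := Function.Periodic.lift (f := fun t => piG G (flowSph t z)) (c := ℓ) fun t =>
    (piG_eq_iff.2 ⟨g, hg, by
      rw [← flowSph_smul, mem_eigV_iff_smul.1 hz, ← flowSph_add]⟩).symm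
  flow t := by
    change piG G (flowSph t z) = flowG G t (piG G (flowSph 0 z))
    rw [flowSph_zero]
    rfl

theorem flowSph_mem_eigV {g : SU m} {ℓ : ℝ} {z : Sph m} (hz : z.1 ∈ eigV g ℓ) (t : ℝ) :
    (flowSph t z).1 ∈ eigV g ℓ := (eigV g ℓ).smul_mem _ hz

/-- Whatever point of `B_{g,ℓ}` an orbit starts at, its index is given by the eigenvalues of `g`. -/
theorem isCZ_familyB [NeZero m] [Finite G] (hG : ActsFreely G) {g : SU m} (hg : g ∈ G) {ℓ : ℝ}
    (hℓ : 0 < ℓ) (hV : eigV g ℓ ≠ ⊥) {c : ℝ}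
    (hc : ∀ F : EigenFrame g, ((m + 1 : ℕ) : ℝ) * ℓ / π +
      2 * ∑ j, sawtooth (Complex.exp ((ℓ - F.angle j : ℝ) * Complex.I)) = c) :
    IsCZ (familyB G g ℓ) ℓ c := by
  refine ⟨?_, ?_, ?_⟩
  · obtain ⟨z, hz⟩ := exists_unit_mem_eigV hV
    exact ⟨_, z, hz, rfl⟩
  · rintro _ ⟨z, hz, rfl⟩
    refine ⟨orbitOfEigenvector hg hz, ?_, fun s => ?_⟩
    · exact congrArg (piG G) (flowSph_zero z)
    · obtain ⟨t, rfl⟩ := QuotientAddGroup.mk_surjective s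
      exact ⟨flowSph t z, flowSph_mem_eigV hz t, rfl⟩
  · rintro γ ⟨z, hz, hzγ⟩
    refine ⟨nonempty_compatibleTrivialization hG hℓ.ne' hg hzγ hz, fun τ => ?_⟩
    obtain ⟨F, hF⟩ := exists_eigenFrame (mem_sphere_zero_iff_norm.1 z.2) hz
    rw [τ.czIndex_flowMatrix hℓ.le hg hzγ hz F hF, hc]

theorem IsCZ.unique {B : Set (SG G)} {ℓ c c' : ℝ} (h : IsCZ B ℓ c) (h' : IsCZ B ℓ c') :
    c = c' := by
  obtain ⟨p, hp⟩ := h.1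
  obtain ⟨γ, rfl, -⟩ := h.2.1 p hp
  obtain ⟨⟨τ⟩, hτ⟩ := h.2.2 γ hp
  rw [← hτ τ, ← (h'.2.2 γ hp).2 τ]

theorem exp_add_two_pi_mul (x : ℝ) (k : ℕ) :
    Complex.exp ((x + 2 * π * k : ℝ) * Complex.I) = Complex.exp (x * Complex.I) := by
  rw [Complex.exp_eq_exp_iff_exists_int]
  exact ⟨k, by push_cast; ring⟩

theorem eigV_add_two_pi_mul (g : SU m) (ℓ : ℝ) (k : ℕ) :
    eigV g (ℓ + 2 * π * k) = eigV g ℓ := by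
  ext v
  rw [mem_eigV, mem_eigV, exp_add_two_pi_mul]

theorem familyB_add_two_pi_mul (g : SU m) (ℓ : ℝ) (k : ℕ) :
    familyB G g (ℓ + 2 * π * k) = familyB G g ℓ := by
  unfold familyB
  rw [eigV_add_two_pi_mul]

theorem dimBelow_eq_zero_of_isMinimal {g : SU m} {ℓ : ℝ} (hℓ : ℓ ≤ 2 * π) (h : IsMinimal g ℓ) :
    dimBelow g ℓ = 0 := by
  refine finsum_mem_eq_zero_of_forall_eq_zero fun x hx => ?_
  have : eigV g x = ⊥ := by
    by_contra hne
    exact absurd (h.2 ⟨⟨hx.1, hx.2.le.trans hℓ⟩, hne⟩) (not_le.2 hx.2)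
  rw [this, finrank_bot, Nat.cast_zero]

/-- The index of `B_{g,ℓ}` and of its iterates. -/
theorem isCZ_familyB_add [NeZero m] [Finite G] (hG : ActsFreely G) {g : SU m} (hg : g ∈ G) {ℓ : ℝ}
    (hℓ : ℓ ∈ Set.Ioc 0 (2 * π)) (hV : eigV g ℓ ≠ ⊥) (k : ℕ) :
    IsCZ (familyB G g (ℓ + 2 * π * k)) (ℓ + 2 * π * k)
      (((m + 1 : ℕ) : ℝ) - 2 * age g + 2 * dimBelow g ℓ
        + (realDim (familyB G g ℓ) : ℝ) / 2 + 1 / 2 + 2 * k * ((m + 1 : ℕ) : ℝ)) := by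
  have hπ := Real.pi_pos
  refine isCZ_familyB hG hg (by have := hℓ.1; positivity) (by rwa [eigV_add_two_pi_mul]) fun F => ?_
  have h := F.sum_sawtooth hℓ
  have h2 : ∀ j, Complex.exp ((ℓ + 2 * π * k - F.angle j : ℝ) * Complex.I) =
      Complex.exp ((ℓ - F.angle j : ℝ) * Complex.I) := fun j => by
    rw [← exp_add_two_pi_mul (ℓ - F.angle j) k, sub_add_eq_add_sub]
  simp only [h2]
  rw [realDim_familyB hG hg hV, mul_add, add_div,
    show ((m + 1 : ℕ) : ℝ) * (2 * π * k) / π = 2 * k * ((m + 1 : ℕ) : ℝ) by field_simp]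
  linarith

end QuotientCZ

end

theorem mainTheorem5 (m : ℕ) (hm : 1 ≤ m)
    (G : Subgroup (QuotientCZ.SU m)) [Finite G] (hG : QuotientCZ.ActsFreely G)
    (g : QuotientCZ.SU m) (hg : g ∈ G)
    (ℓ : ℝ) (hℓ : 0 < ℓ) (hℓ' : ℓ ≤ 2 * Real.pi) (hV : QuotientCZ.eigV g ℓ ≠ ⊥) :
    -- the index of `B`, with `n = m + 1`
    QuotientCZ.IsCZ (QuotientCZ.familyB G g ℓ) ℓ
      (((m + 1 : ℕ) : ℝ) - 2 * QuotientCZ.age g + 2 * QuotientCZ.dimBelow g ℓ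
        + (QuotientCZ.realDim (QuotientCZ.familyB G g ℓ) : ℝ) / 2 + 1 / 2) ∧
    -- the grading of `B`
    QuotientCZ.IsGrading (QuotientCZ.familyB G g ℓ) ℓ
      (2 * QuotientCZ.age g - 2 * QuotientCZ.dimBelow g ℓ
        - (QuotientCZ.realDim (QuotientCZ.familyB G g ℓ) : ℝ) - 1) ∧
    -- iteration
    (∀ (k : ℕ) (c : ℝ), QuotientCZ.IsCZ (QuotientCZ.familyB G g ℓ) ℓ c →
      QuotientCZ.IsCZ (QuotientCZ.familyB G g (ℓ + 2 * Real.pi * k)) (ℓ + 2 * Real.pi * k)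
        (c + 2 * k * ((m + 1 : ℕ) : ℝ))) ∧
    (∀ (k : ℕ) (μ : ℝ), QuotientCZ.IsGrading (QuotientCZ.familyB G g ℓ) ℓ μ →
      QuotientCZ.IsGrading (QuotientCZ.familyB G g (ℓ + 2 * Real.pi * k)) (ℓ + 2 * Real.pi * k)
        (μ - 2 * k * ((m + 1 : ℕ) : ℝ))) ∧
    -- the minimal eigenvalue
    (QuotientCZ.IsMinimal g ℓ →
      QuotientCZ.IsGrading (QuotientCZ.familyB G g ℓ) ℓ
        (2 * QuotientCZ.age g - (QuotientCZ.realDim (QuotientCZ.familyB G g ℓ) : ℝ) - 1) ∧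
      QuotientCZ.IsMaxGrading (QuotientCZ.familyB G g ℓ) ℓ (2 * QuotientCZ.age g - 1) ∧
      ∀ γ : QuotientCZ.ReebOrbit G ℓ, γ.toFun 0 ∈ QuotientCZ.familyB G g ℓ →
        QuotientCZ.IsMinimalOrbit g γ) := by
  have : NeZero m := ⟨by omega⟩
  have hadd := QuotientCZ.isCZ_familyB_add hG hg ⟨hℓ, hℓ'⟩ hV
  have hCZ : QuotientCZ.IsCZ (QuotientCZ.familyB G g ℓ) ℓ
      (((m + 1 : ℕ) : ℝ) - 2 * QuotientCZ.age g + 2 * QuotientCZ.dimBelow g ℓ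
        + (QuotientCZ.realDim (QuotientCZ.familyB G g ℓ) : ℝ) / 2 + 1 / 2) := by
    simpa using hadd 0
  have hiter : ∀ (k : ℕ) (c : ℝ), QuotientCZ.IsCZ (QuotientCZ.familyB G g ℓ) ℓ c →
      QuotientCZ.IsCZ (QuotientCZ.familyB G g (ℓ + 2 * Real.pi * k)) (ℓ + 2 * Real.pi * k)
        (c + 2 * k * ((m + 1 : ℕ) : ℝ)) := by
    intro k c hc
    rw [hc.unique hCZ]
    exact hadd k
  refine ⟨hCZ, ⟨_, hCZ, by ring⟩, hiter, ?_, fun hmin => ?_⟩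
  · rintro k _ ⟨c, hc, rfl⟩
    refine ⟨_, hiter k c hc, ?_⟩
    rw [QuotientCZ.familyB_add_two_pi_mul]
    ring
  · have hgr : QuotientCZ.IsGrading (QuotientCZ.familyB G g ℓ) ℓ
        (2 * QuotientCZ.age g - (QuotientCZ.realDim (QuotientCZ.familyB G g ℓ) : ℝ) - 1) := by
      refine ⟨_, hCZ, ?_⟩
      rw [QuotientCZ.dimBelow_eq_zero_of_isMinimal hℓ' hmin]
      ring
    refine ⟨hgr, ⟨_, hgr, by ring⟩, ?_⟩
    rintro γ ⟨z, hz, hzγ⟩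
    exact ⟨hmin, z, hz, fun t => (γ.piG_flowSph hzγ t).symm⟩
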